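/- Let $d\ge 1$ and let $\Omega\subseteq\mathbb{R}^d$ be an open set with piecewise smooth boundary, meaning that $\partial\Omega$ has finite $(d-1)$-dimensional surface area in every ball and that, outside a subset of $\partial\Omega$ of surface area zero, $\partial\Omega$ is locally a $C^\infty$ hypersurface with $\Omega$ on exactly one side (for $\Omega=\mathbb{R}^d$ the boundary is empty). Let $\boldsymbol{n}$ denote the outward unit normal and $S$ the surface measure. Let $\pi$ be a probability density on $\Omega$ with respect to Lebesgue measure, with $\pi(\boldsymbol{x})>0$ for all $\boldsymbol{x}\in\Omega$, and write $\mu(g)=\int_\Omega g(\boldsymbol{x})\pi(\boldsymbol{x})\,\mathrm{d}\boldsymbol{x}$. Assume (A1) $\pi\in C^1(\Omega,\mathbb{R})$. Let $\boldsymbol{\phi}\in C^1(\Omega,\mathbb{R}^d)$, $c\in\mathbb{R}$, and put $$\psi(\boldsymbol{x})=\nabla\cdot\boldsymbol{\phi}(\boldsymbol{x})+\boldsymbol{\phi}(\boldsymbol{x})\cdot\nabla\log\pi(\boldsymbol{x}),\qquad s_{f,\mathcal{D}_0}(\boldsymbol{x})=c+\psi(\boldsymbol{x})\qquad(\boldsymbol{x}\in\Omega).$$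 Assume that $\psi$ is $\pi$-integrable, i.e. $\int_\Omega|\psi|\pi\,\mathrm{d}\boldsymbol{x}<\infty$, and that $\pi\boldsymbol{\phi}$ extends continuously to $\overline{\Omega}$ (the extension, again written $\pi\boldsymbol{\phi}$, gives its values on $\partial\Omega$). Assume moreover (A2) if $\Omega$ is bounded, then $\oint_{\partial\Omega}\pi(\boldsymbol{x})\boldsymbol{\phi}(\boldsymbol{x})\cdot\boldsymbol{n}(\boldsymbol{x})\,S(\mathrm{d}\boldsymbol{x})=0$; if $\Omega$ is unbounded, then, as $r\to\infty$, $$\oint_{\Gamma_r\cap\Omega}\pi(\boldsymbol{x})\boldsymbol{\phi}(\boldsymbol{x})\cdot\frac{\boldsymbol{x}}{r}\,S(\mathrm{d}\boldsymbol{x})\to 0\quad\text{and}\quad\int_{\partial\Omega\cap\{\|\boldsymbol{x}\|<r\}}\pi(\boldsymbol{x})\boldsymbol{\phi}(\boldsymbol{x})\cdot\boldsymbol{n}(\boldsymbol{x})\,S(\mathrm{d}\boldsymbol{x})\to 0,$$ where $\Gamma_r$ is the sphere of radius $r$ centred at the origin (the second condition is void if $\Omega=\mathbb{R}^d$). Then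 $\mu(\psi)=0$, and hence $\mu(s_{f,\mathcal{D}_0})=c$. -/

import Mathlib

open scoped MeasureTheory ContDiff

noncomputable section

/-- `ν` is the outward unit normal to the boundary of `Ω` at the smooth boundary point `x`: in an
open neighbourhood `U` of `x` the set `Ω` is the sublevel set `{g < 0}` of a smooth function `g`
with `g x = 0` and nonzero gradient at `x`, and `ν` is the normalized gradient of `g` at `x`. -/
def IsOutwardUnitNormal {d : ℕ} (Ω : Set (EuclideanSpace ℝ (Fin d)))
    (x ν : EuclideanSpace ℝ (Fin d)) : Prop :=
  ∃ (U : Set (EuclideanSpace ℝ (Fin d))) (g : EuclideanSpace ℝ (Fin d) → ℝ),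
    IsOpen U ∧ x ∈ U ∧ ContDiffOn ℝ ∞ g U ∧ g x = 0 ∧ gradient g x ≠ 0 ∧
    (∀ y ∈ U, y ∈ Ω ↔ g y < 0) ∧ ν = ‖gradient g x‖⁻¹ • gradient g x

/-- The outward unit normal does not depend on the local defining function. -/
theorem IsOutwardUnitNormal.unique {d : ℕ} {Ω : Set (EuclideanSpace ℝ (Fin d))}
    {x ν ν' : EuclideanSpace ℝ (Fin d)}
    (h : IsOutwardUnitNormal Ω x ν) (h' : IsOutwardUnitNormal Ω x ν') : ν = ν' := by
  obtain ⟨U, g, hU, hxU, hg, hgx, hg0, hgΩ, rfl⟩ := h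
  obtain ⟨V, k, hV, hxV, hk, hkx, hk0, hkΩ, rfl⟩ := h'
  have key : ∀ (w : EuclideanSpace ℝ (Fin d)) (q : EuclideanSpace ℝ (Fin d) → ℝ)
      (W : Set (EuclideanSpace ℝ (Fin d))), IsOpen W → x ∈ W → ContDiffOn ℝ ∞ q W → q x = 0 →
      HasDerivAt (fun t : ℝ => q (x + t • w)) (inner ℝ (gradient q x) w) 0 := by
    intro w q W hW hxW hq hqx
    have hd : DifferentiableAt ℝ q x :=
      (hq.contDiffAt (hW.mem_nhds hxW)).differentiableAt (by simp)
    have h1 : HasFDerivAt q (InnerProductSpace.toDual ℝ _ (gradient q x)) (x + (0 : ℝ) • w) := by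
      simpa using hd.hasGradientAt.hasFDerivAt
    have h2 : HasDerivAt (fun t : ℝ => x + t • w) w 0 := by
      simpa using ((hasDerivAt_id (0 : ℝ)).smul_const w).const_add x
    exact h1.comp_hasDerivAt (0 : ℝ) h2
  have hmem : ∀ w : EuclideanSpace ℝ (Fin d),
      ∀ᶠ t : ℝ in nhdsWithin 0 (Set.Ioi 0), x + t • w ∈ U ∩ V := by
    intro w
    have hc : Continuous (fun t : ℝ => x + t • w) := by fun_prop
    have : ∀ᶠ t : ℝ in nhds 0, x + t • w ∈ U ∩ V :=
      hc.continuousAt.eventually ((hU.inter hV).mem_nhds (by simpa using ⟨hxU, hxV⟩))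
    exact this.filter_mono nhdsWithin_le_nhds
  have main : ∀ w : EuclideanSpace ℝ (Fin d), inner ℝ (gradient g x) w < 0 →
      inner ℝ (gradient k x) w ≤ 0 := by
    intro w hw
    by_contra hcon
    push Not at hcon
    have e1 := (hasDerivAt_iff_tendsto_slope_zero.1 (key w g U hU hxU hg hgx)).mono_left
      (nhdsWithin_mono 0 (show Set.Ioi (0 : ℝ) ⊆ {0}ᶜ from fun t ht => ne_of_gt ht))
    have e2 := (hasDerivAt_iff_tendsto_slope_zero.1 (key w k V hV hxV hk hkx)).mono_left
      (nhdsWithin_mono 0 (show Set.Ioi (0 : ℝ) ⊆ {0}ᶜ from fun t ht => ne_of_gt ht))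
    obtain ⟨t, ⟨⟨h1, h2⟩, ht⟩, h3⟩ := (((e1.eventually (gt_mem_nhds hw)).and
      (e2.eventually (lt_mem_nhds hcon))).and self_mem_nhdsWithin |>.and (hmem w)).exists
    have ht0 : (0 : ℝ) < t := ht
    simp only [zero_add, zero_smul, add_zero, hgx, hkx, sub_zero, smul_eq_mul] at h1 h2
    have g1 : g (x + t • w) < 0 := by
      by_contra hc
      have := mul_nonneg (inv_pos.2 ht0).le (not_lt.1 hc)
      linarith
    have k1 : k (x + t • w) < 0 := (hkΩ _ h3.2).1 ((hgΩ _ h3.1).2 g1)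
    have := mul_neg_of_pos_of_neg (inv_pos.2 ht0) k1
    linarith
  set a := gradient g x
  set b := gradient k x
  have ha : 0 < ‖a‖ := norm_pos_iff.2 hg0
  have hb : 0 < ‖b‖ := norm_pos_iff.2 hk0
  have hclosed : ∀ w : EuclideanSpace ℝ (Fin d), inner ℝ a w ≤ 0 → inner ℝ b w ≤ 0 := by
    intro w hw
    have hlim : Filter.Tendsto (fun t : ℝ => inner ℝ b (w - t • a)) (nhdsWithin 0 (Set.Ioi 0))
        (nhds (inner ℝ b w)) := by
      have hc : Continuous (fun t : ℝ => inner ℝ b (w - t • a)) := by fun_prop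
      simpa using hc.continuousAt.tendsto.mono_left (nhdsWithin_le_nhds (a := (0 : ℝ)))
    refine le_of_tendsto hlim ?_
    filter_upwards [self_mem_nhdsWithin] with t ht
    apply main
    have ht0 : (0 : ℝ) < t := ht
    rw [inner_sub_right, inner_smul_right, real_inner_self_eq_norm_sq]
    have : 0 < t * ‖a‖ ^ 2 := by positivity
    linarith
  have h1 := hclosed (‖a‖ • b - ‖b‖ • a)
  have h2 : inner ℝ a (‖a‖ • b - ‖b‖ • a) ≤ 0 := by
    rw [inner_sub_right, inner_smul_right, inner_smul_right, real_inner_self_eq_norm_sq]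
    nlinarith [real_inner_le_norm a b]
  have h3 := h1 h2
  rw [inner_sub_right, inner_smul_right, inner_smul_right, real_inner_self_eq_norm_sq] at h3
  have h4 : inner ℝ a b = ‖a‖ * ‖b‖ := by
    have := real_inner_le_norm a b
    rw [real_inner_comm] at h3
    nlinarith
  have h5 := (inner_eq_norm_mul_iff_real (x := a) (y := b)).1 h4
  have h6 : a = (‖a‖ * ‖b‖⁻¹) • b := by
    rw [mul_comm, mul_smul, ← h5, smul_smul, inv_mul_cancel₀ hb.ne', one_smul]
  rw [h6]
  simp only [norm_smul, smul_smul, norm_mul, norm_norm, norm_inv]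
  congr 1
  field_simp

open Classical in
/-- The outward unit normal field of `Ω` on the smooth part of its boundary (zero elsewhere). -/
def outwardUnitNormal {d : ℕ} (Ω : Set (EuclideanSpace ℝ (Fin d)))
    (x : EuclideanSpace ℝ (Fin d)) : EuclideanSpace ℝ (Fin d) :=
  if h : ∃ ν, IsOutwardUnitNormal Ω x ν then h.choose else 0

/-- The boundary of `Ω` is piecewise smooth: it has finite surface area in bounded regions, and
outside a set of surface area zero (edges, corners, ...) it is locally a smooth hypersurface with
`Ω` on one side, so that it has an outward unit normal there. The surface area is the
`(d-1)`-dimensional Euclidean Hausdorff measure. -/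
def HasPiecewiseSmoothBoundary {d : ℕ} (Ω : Set (EuclideanSpace ℝ (Fin d))) : Prop :=
  (∀ r : ℝ, μHE[d - 1] (frontier Ω ∩ Metric.closedBall 0 r) < ⊤) ∧
  μHE[d - 1] {x | x ∈ frontier Ω ∧ ¬ ∃ ν, IsOutwardUnitNormal Ω x ν} = 0

/-- The surface integral of `F · n` over the part of the boundary of `Ω` that lies in `A`, where
`n` is the outward unit normal. -/
def boundaryFlux {d : ℕ} (Ω : Set (EuclideanSpace ℝ (Fin d)))
    (F : EuclideanSpace ℝ (Fin d) → EuclideanSpace ℝ (Fin d))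
    (A : Set (EuclideanSpace ℝ (Fin d))) : ℝ :=
  ∫ x in frontier Ω ∩ A, inner ℝ (F x) (outwardUnitNormal Ω x) ∂μHE[d - 1]

open Classical in
/-- The surface integral of `F · n` over `Γ_r ∩ Ω`, where `Γ_r` is the sphere of radius `r > 0`
centred at the origin and `n` its outward unit normal, in the parametrization `x = r θ`, `‖θ‖ = 1`,
`n = θ`, `S(dx) = r ^ (d - 1) S(dθ)`. -/
def sphereFlux {d : ℕ} (Ω : Set (EuclideanSpace ℝ (Fin d)))
    (F : EuclideanSpace ℝ (Fin d) → EuclideanSpace ℝ (Fin d)) (r : ℝ) : ℝ :=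
  r ^ (d - 1) * ∫ θ : Metric.sphere (0 : EuclideanSpace ℝ (Fin d)) 1,
    (if r • (θ : EuclideanSpace ℝ (Fin d)) ∈ Ω then
      inner ℝ (F (r • (θ : EuclideanSpace ℝ (Fin d)))) (θ : EuclideanSpace ℝ (Fin d)) else 0)
    ∂(MeasureTheory.volume : MeasureTheory.Measure (EuclideanSpace ℝ (Fin d))).toSphere

/-- The boundary condition on a field `F` on `closure Ω`. For bounded `Ω`, the surface integral
of `F · n` over the boundary vanishes. For unbounded `Ω`, the surface integral of `F · n` over
`Γ_r ∩ Ω` tends to zero as `r → ∞`, and the surface integral over the boundary (if there is any),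
taken as a limit over growing balls, vanishes. -/
def SteinBoundaryCondition {d : ℕ} (Ω : Set (EuclideanSpace ℝ (Fin d)))
    (F : EuclideanSpace ℝ (Fin d) → EuclideanSpace ℝ (Fin d)) : Prop :=
  (Bornology.IsBounded Ω → boundaryFlux Ω F Set.univ = 0) ∧
  (¬ Bornology.IsBounded Ω →
    Filter.Tendsto (fun r : ℝ => sphereFlux Ω F r) Filter.atTop (nhds 0) ∧
    Filter.Tendsto (fun r : ℝ => boundaryFlux Ω F (Metric.ball 0 r)) Filter.atTop (nhds 0))

/-- The divergence of a vector field. -/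
def divergence {d : ℕ} (φ : EuclideanSpace ℝ (Fin d) → EuclideanSpace ℝ (Fin d))
    (x : EuclideanSpace ℝ (Fin d)) : ℝ :=
  ∑ i : Fin d, (fderiv ℝ φ x (EuclideanSpace.single i 1)) i

/-- The Stein control variate `ψ = ∇ · φ + φ · ∇ log π`. -/
def steinControl {d : ℕ} (π : EuclideanSpace ℝ (Fin d) → ℝ)
    (φ : EuclideanSpace ℝ (Fin d) → EuclideanSpace ℝ (Fin d)) (x : EuclideanSpace ℝ (Fin d)) : ℝ :=
  divergence φ x + inner ℝ (φ x) (gradient (fun y => Real.log (π y)) x)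

/-- The expectation `μ(g) = ∫_Ω g(x) π(x) dx`. -/
def expectation {d : ℕ} (Ω : Set (EuclideanSpace ℝ (Fin d))) (π g : EuclideanSpace ℝ (Fin d) → ℝ) :
    ℝ :=
  ∫ x in Ω, g x * π x

end

/-!
On `Ω` the product of the Stein control variate `∇ · φ + φ · ∇ log π` with `π` is the divergence of
`F = π φ`, so the claim is that `∫_Ω div F` vanishes. This follows from the Gauss–Green formula
`∫_Ω div (χ F) = ∫_∂Ω χ F · n` for compactly supported `C¹` functions `χ`
(`IsFluxField.gaussGreenDefect_eq_zero`). For bounded `Ω` one takes `χ = 1` near `closure Ω`. For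
unbounded `Ω` one takes radial cutoffs `χ_k` tending to one; in polar coordinates `∫_Ω ∇χ_k · F` is
an average of the fluxes through `Γ_r ∩ Ω` over large radii `r`, and by Fubini `∫_∂Ω χ_k F · n` is
an average of the fluxes through `∂Ω ∩ {‖x‖ < r}` with the same weight, so that both tend to zero
(`IsFluxField.integral_radialCutoff_mul_divergence`).

The Gauss–Green formula is proved without an area formula. Near a regular boundary point with
normal `ν`, the set `Ω` lies below a graph of slope at most `η` over the hyperplane orthogonal to
`ν`, with `η` as small as desired. For a direction `e` transversal to the boundary, the fundamental
theorem of calculus on the lines in direction `e` expresses `∫_Ω ∂_e u` as `⟪ν, e⟫` times the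
integral of the boundary values of `u` over that hyperplane. The projection of the boundary along
`e` is a near-isometry, hence changes the Hausdorff measure by a factor close to one, and
`∫_Ω ∂_e u` equals `⟪ν, e⟫ ∫_∂Ω u` up to a small multiple of `∫_∂Ω |u|`
(`IsConeSublevel.abs_integral_fderiv_sub_le`). Coordinate directions are differences of transversal
ones, and the normal is close to `ν`, so the Gauss–Green formula holds up to a small multiple of
`∫_∂Ω ‖χ F‖` for cutoffs `χ` with small support. Only `div F` is integrable, not each partial
derivative, so this is applied to fields shifted by `t ν`, with `t → 0`
(`IsConeSublevel.abs_integral_divergence_sub_le`). The errors add up in a partition of unity to a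
small multiple of the total `∫_∂Ω ‖χ F‖`, and are therefore zero.

The singular part of the boundary is closed and has surface area zero. Its intersection with the
support of `χ` is covered by finitely many balls of radii `r_i` with `∑ r_i ^ (d - 1)` small, and
cutoffs that vanish on these balls have gradients with small integral (`exists_cutoff_balls`).
-/

open MeasureTheory Measure Module Set Filter Topology


/-! ### Near-isometries and Hausdorff measure -/

/-- Integrals against measures whose ratio is within `δ` of one are close. -/
theorem abs_integral_sub_le_of_measure_le {α : Type*} {m : MeasurableSpace α} {μ ν : Measure α}
    {δ : ℝ} (h₁ : ENNReal.ofReal (1 - δ) • μ ≤ ν)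
    (h₂ : ν ≤ ENNReal.ofReal (1 + δ) • μ) {f : α → ℝ} (hf : Integrable f μ) (hδ : 0 ≤ δ)
    (hδ1 : δ ≤ 1) :
    |∫ x, f x ∂ν - ∫ x, f x ∂μ| ≤ δ * ∫ x, |f x| ∂μ := by
  have key : ∀ g : α → ℝ, Integrable g μ → 0 ≤ g →
      |∫ x, g x ∂ν - ∫ x, g x ∂μ| ≤ δ * ∫ x, g x ∂μ := by
    intro g hg hg0
    have hbig : Integrable g (ENNReal.ofReal (1 + δ) • μ) := hg.smul_measure ENNReal.ofReal_ne_top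
    have hν : Integrable g ν := hbig.mono_measure h₂
    have e₁ := integral_mono_measure h₁ (Eventually.of_forall hg0) hν
    have e₂ := integral_mono_measure h₂ (Eventually.of_forall hg0) hbig
    rw [integral_smul_measure, ENNReal.toReal_ofReal (by linarith), smul_eq_mul] at e₁ e₂
    rw [abs_le]
    constructor <;> linarith
  have hν : Integrable f ν := (hf.smul_measure ENNReal.ofReal_ne_top).mono_measure h₂
  have hp := key _ hf.pos_part (fun x => le_max_right _ _)
  have hn := key _ hf.neg_part (fun x => le_max_right _ _)
  have d : ∀ ρ : Measure α, Integrable f ρ →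
      ∫ x, f x ∂ρ = ∫ x, max (f x) 0 ∂ρ - ∫ x, max (-f x) 0 ∂ρ := by
    intro ρ hρ
    rw [← integral_sub hρ.pos_part hρ.neg_part]
    exact integral_congr_ae (Eventually.of_forall fun x => (max_zero_sub_eq_self (f x)).symm)
  have a : ∫ x, |f x| ∂μ = ∫ x, max (f x) 0 ∂μ + ∫ x, max (-f x) 0 ∂μ := by
    rw [← integral_add hf.pos_part hf.neg_part]
    exact integral_congr_ae (Eventually.of_forall fun x => (max_zero_add_max_neg_zero_eq_abs_self (f x)).symm)
  rw [d μ hf, d ν hν, a]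
  rw [abs_le] at hp hn ⊢
  constructor <;> linarith [hp.1, hp.2, hn.1, hn.2]

theorem LipschitzOnWith.euclideanHausdorffMeasure_image_le {X Y : Type*} [EMetricSpace X]
    [MeasurableSpace X] [BorelSpace X] [EMetricSpace Y] [MeasurableSpace Y] [BorelSpace Y]
    {K : NNReal} {f : X → Y} {s : Set X} (h : LipschitzOnWith K f s) (n : ℕ) :
    μHE[n] (f '' s) ≤ (K : ENNReal) ^ n * μHE[n] s := by
  rw [euclideanHausdorffMeasure_def, euclideanHausdorffMeasure_def, Measure.smul_apply, Measure.smul_apply,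
    ENNReal.smul_def, ENNReal.smul_def, smul_eq_mul, smul_eq_mul, mul_left_comm]
  gcongr
  have := h.hausdorffMeasure_image_le (d := n) (by positivity)
  simpa using this

section
variable {X Y : Type*} [MetricSpace X] [MetricSpace Y]

/-- On `M` the map `q` distorts distances by a factor between `1 - η` and `1 + η`. -/
def NearIsometryOn (q : X → Y) (M : Set X) (η : ℝ) : Prop :=
  ∀ x ∈ M, ∀ x' ∈ M, (1 - η) * dist x x' ≤ dist (q x) (q x') ∧
    dist (q x) (q x') ≤ (1 + η) * dist x x'

theorem NearIsometryOn.mono {q : X → Y} {M S : Set X} {η : ℝ} (h : NearIsometryOn q M η)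
    (hS : S ⊆ M) : NearIsometryOn q S η := fun x hx x' hx' => h x (hS hx) x' (hS hx')

theorem NearIsometryOn.injOn {q : X → Y} {M : Set X} {η : ℝ} (h : NearIsometryOn q M η)
    (hη : η < 1) : InjOn q M := by
  intro x hx x' hx' e
  have := (h x hx x' hx').1
  rw [e, dist_self] at this
  have h2 : dist x x' ≤ 0 := by
    by_contra hc
    have := mul_pos (sub_pos.2 hη) (not_le.1 hc)
    linarith
  exact dist_le_zero.1 h2

variable [MeasurableSpace X] [BorelSpace X] [MeasurableSpace Y] [BorelSpace Y]

theorem NearIsometryOn.measure_image_le {q : X → Y} {M : Set X} {η : ℝ}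
    (h : NearIsometryOn q M η) (hη0 : 0 ≤ η) (n : ℕ) :
    μHE[n] (q '' M) ≤ ENNReal.ofReal ((1 + η) ^ n) * μHE[n] M := by
  have hL : LipschitzOnWith (1 + η).toNNReal q M :=
    LipschitzOnWith.of_dist_le_mul fun x hx x' hx' => by
      rw [Real.coe_toNNReal _ (by linarith)]
      exact (h x hx x' hx').2
  refine (hL.euclideanHausdorffMeasure_image_le n).trans_eq ?_
  rw [ENNReal.ofReal_pow (by linarith)]
  rfl

theorem NearIsometryOn.le_measure_image {q : X → Y} {M : Set X} {η : ℝ}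
    (h : NearIsometryOn q M η) (hη : η < 1) (n : ℕ) :
    ENNReal.ofReal ((1 - η) ^ n) * μHE[n] M ≤ μHE[n] (q '' M) := by
  rcases M.eq_empty_or_nonempty with rfl | ⟨x₀, -⟩
  · simp
  have : Nonempty X := ⟨x₀⟩
  have hinj := h.injOn hη
  have hη' : 0 < 1 - η := by linarith
  have hL : LipschitzOnWith (1 - η)⁻¹.toNNReal (Function.invFunOn q M) (q '' M) := by
    refine LipschitzOnWith.of_dist_le_mul ?_
    rintro _ ⟨x, hx, rfl⟩ _ ⟨x', hx', rfl⟩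
    rw [hinj.leftInvOn_invFunOn hx, hinj.leftInvOn_invFunOn hx',
      Real.coe_toNNReal _ (by positivity)]
    have := (h x hx x' hx').1
    rw [inv_mul_eq_div, le_div_iff₀ hη']
    linarith
  have h1 := hL.euclideanHausdorffMeasure_image_le n
  rw [hinj.leftInvOn_invFunOn.image_image] at h1
  calc _ ≤ ENNReal.ofReal ((1 - η) ^ n) * (((1 - η)⁻¹.toNNReal : ENNReal) ^ n * μHE[n] (q '' M)) := by
        gcongr
    _ = μHE[n] (q '' M) := by
        rw [← mul_assoc, show (((1 - η)⁻¹.toNNReal : NNReal) : ENNReal)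
          = ENNReal.ofReal ((1 - η)⁻¹) from rfl, ← ENNReal.ofReal_pow (by positivity),
          ← ENNReal.ofReal_mul (by positivity), ← mul_pow, mul_inv_cancel₀ hη'.ne']
        simp

/-- The image of `M` under a near-isometry carries almost the pushforward of the measure on `M`:
the upper bound. -/
theorem NearIsometryOn.restrict_image_le {q : X → Y} {M : Set X} {η δ : ℝ} {n : ℕ}
    (h : NearIsometryOn q M η) (hη0 : 0 ≤ η) (hq : Measurable q)
    (hδ : (1 + η) ^ n ≤ 1 + δ) :
    (μHE[n] : Measure Y).restrict (q '' M) ≤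
      ENNReal.ofReal (1 + δ) • ((μHE[n] : Measure X).restrict M).map q := by
  refine le_intro fun A hA _ => ?_
  rw [restrict_apply hA, Measure.smul_apply, map_apply hq hA, restrict_apply (hq hA), smul_eq_mul,
    ← image_preimage_inter]
  exact ((h.mono inter_subset_right).measure_image_le hη0 n).trans (by gcongr)

/-- The lower bound that goes with `NearIsometryOn.restrict_image_le`. -/
theorem NearIsometryOn.le_restrict_image {q : X → Y} {M : Set X} {η δ : ℝ} {n : ℕ}
    (h : NearIsometryOn q M η) (hη : η < 1) (hq : Measurable q)
    (hδ : 1 - δ ≤ (1 - η) ^ n) :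
    ENNReal.ofReal (1 - δ) • ((μHE[n] : Measure X).restrict M).map q ≤
      (μHE[n] : Measure Y).restrict (q '' M) := by
  refine le_intro fun A hA _ => ?_
  rw [restrict_apply hA, Measure.smul_apply, map_apply hq hA, restrict_apply (hq hA), smul_eq_mul,
    ← image_preimage_inter]
  exact le_trans (by gcongr) ((h.mono inter_subset_right).le_measure_image hη n)
end

/-! ### Oblique coordinates -/

section
variable {E : Type*} [NormedAddCommGroup E] [InnerProductSpace ℝ E] [FiniteDimensional ℝ E]
  [MeasurableSpace E] [BorelSpace E]

theorem measurePreserving_orthogonal_coordinates {ν : E} (hν : ‖ν‖ = 1) :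
    MeasurePreserving (fun p : (ℝ ∙ ν)ᗮ × ℝ => (p.1 : E) + p.2 • ν) := by
  have h1 := ((ℝ ∙ ν).measurePreserving_measurableEquivProd (0 : E)).symm
  rw [InnerProductSpace.euclideanHausdorffMeasure_eq_volume] at h1
  have h2 := (LinearIsometryEquiv.toSpanUnitSingleton (𝕜 := ℝ) ν hν).measurePreserving
  have h3 := h1.comp ((h2.prod (MeasurePreserving.id (volume : Measure (ℝ ∙ ν)ᗮ))).comp
    Measure.measurePreserving_swap)
  convert h3 using 1
  · ext1 p
    simp [add_comm]
  · exact volume_eq_prod _ _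

/-- Lebesgue measure in the coordinates `x = y + s e` with `y ⟂ ν`. -/
theorem map_oblique_coordinates {ν e : E} (hν : ‖ν‖ = 1) (he : 0 < inner ℝ ν e) :
    Measure.map (fun p : (ℝ ∙ ν)ᗮ × ℝ => (p.1 : E) + p.2 • e) volume =
      ENNReal.ofReal (inner ℝ ν e)⁻¹ • volume := by
  have h1 := measurePreserving_orthogonal_coordinates hν
  set T : E →ₗ[ℝ] E := LinearMap.transvection (innerₛₗ ℝ ν) (e - ν) with hT
  have hdet : LinearMap.det T = inner ℝ ν e := by
    rw [hT, LinearMap.transvection.det]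
    simp [inner_sub_right, hν]
  have hcomp : (fun p : (ℝ ∙ ν)ᗮ × ℝ => (p.1 : E) + p.2 • e) =
      T ∘ (fun p : (ℝ ∙ ν)ᗮ × ℝ => (p.1 : E) + p.2 • ν) := by
    ext1 p
    have h0 : inner ℝ ν (p.1 : E) = 0 := Submodule.mem_orthogonal_singleton_iff_inner_right.1 p.1.2
    simp only [hT, Function.comp, LinearMap.transvection.apply, innerₛₗ_apply_apply, inner_add_right, h0,
      inner_smul_right, real_inner_self_eq_norm_sq, hν]
    module
  rw [hcomp, ← Measure.map_map T.continuous_of_finiteDimensional.measurable h1.measurable,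
    h1.map_eq, Measure.map_linearMap_addHaar_eq_smul_addHaar _ (by rw [hdet]; exact he.ne'), hdet,
    abs_of_pos (inv_pos.2 he)]

theorem integrable_oblique_coordinates {ν e : E} (hν : ‖ν‖ = 1) (he : 0 < inner ℝ ν e)
    {f : E → ℝ} (hf : Integrable f) :
    Integrable (fun p : (ℝ ∙ ν)ᗮ × ℝ => f (p.1 + p.2 • e)) (volume.prod volume) := by
  have h1 : Integrable f (Measure.map (fun p : (ℝ ∙ ν)ᗮ × ℝ => (p.1 : E) + p.2 • e) volume) := by
    rw [map_oblique_coordinates hν he]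
    exact hf.smul_measure ENNReal.ofReal_ne_top
  exact h1.comp_measurable (by fun_prop)

theorem integral_eq_oblique_coordinates {ν e : E} (hν : ‖ν‖ = 1) (he : 0 < inner ℝ ν e)
    {f : E → ℝ} (hf : Integrable f) :
    ∫ x, f x = inner ℝ ν e * ∫ y : (ℝ ∙ ν)ᗮ, ∫ s : ℝ, f (y + s • e) := by
  have h1 := map_oblique_coordinates hν he
  have h2 : AEStronglyMeasurable f
      (Measure.map (fun p : (ℝ ∙ ν)ᗮ × ℝ => (p.1 : E) + p.2 • e) volume) := by
    rw [h1]
    exact (hf.smul_measure ENNReal.ofReal_ne_top).aestronglyMeasurable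
  have h3 := integral_map (by fun_prop) h2
  rw [h1, integral_smul_measure, ENNReal.toReal_ofReal (by positivity), smul_eq_mul] at h3
  have h4 := integral_prod _ (integrable_oblique_coordinates hν he hf)
  rw [← h4]
  rw [inv_mul_eq_iff_eq_mul₀ he.ne'] at h3
  exact h3
end

/-! ### Regions below graphs of small slope -/

section
variable {E : Type*} [NormedAddCommGroup E] [InnerProductSpace ℝ E]

/-- In the convex open set `U` the set `Ω` is the sublevel set `{g < 0}` of a continuous function
`g` that increases strictly in all directions making a slope greater than `η` with `ν`. -/
structure IsConeSublevel (Ω U : Set E) (ν : E) (η : ℝ) (g : E → ℝ) : Prop where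
  isOpen : IsOpen U
  convex : Convex ℝ U
  continuousOn : ContinuousOn g U
  mem_iff : ∀ x ∈ U, x ∈ Ω ↔ g x < 0
  lt_of_cone : ∀ x ∈ U, ∀ x' ∈ U, η * ‖x' - x‖ < inner ℝ ν (x' - x) → g x < g x'

namespace IsConeSublevel
variable {Ω U : Set E} {ν : E} {η : ℝ} {g : E → ℝ}

theorem lt_of_sub_eq_smul (h : IsConeSublevel Ω U ν η g) {e : E} (he : η * ‖e‖ < inner ℝ ν e)
    {x x' : E} (hx : x ∈ U) (hx' : x' ∈ U) {t : ℝ} (ht : 0 < t) (hxx : x' - x = t • e) :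
    g x < g x' := by
  apply h.lt_of_cone x hx x' hx'
  rw [hxx, norm_smul, inner_smul_right, Real.norm_of_nonneg ht.le]
  nlinarith

theorem sub_smul_lt (h : IsConeSublevel Ω U ν η g) (hν : ‖ν‖ = 1) (hη : η < 1) {x : E}
    (hx : x ∈ U) {t : ℝ} (ht : 0 < t) (hxt : x - t • ν ∈ U) : g (x - t • ν) < g x := by
  refine h.lt_of_sub_eq_smul (e := ν) ?_ hxt hx ht (by abel)
  rw [real_inner_self_eq_norm_sq, hν]
  linarith

theorem eventually_sub_smul_mem (h : IsConeSublevel Ω U ν η g) {x : E} (hx : x ∈ U) :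
    ∀ᶠ t : ℝ in 𝓝[>] 0, x - t • ν ∈ U := by
  have hc : Continuous (fun t : ℝ => x - t • ν) := by fun_prop
  have h0 : U ∈ 𝓝 ((fun t : ℝ => x - t • ν) 0) := by simpa using h.isOpen.mem_nhds hx
  exact (hc.continuousAt.eventually h0).filter_mono nhdsWithin_le_nhds

theorem le_of_mem_closure (h : IsConeSublevel Ω U ν η g) {x : E} (hx : x ∈ U)
    (hxc : x ∈ closure Ω) : g x ≤ 0 := by
  by_contra hc
  have h1 : ∀ᶠ y in 𝓝 x, 0 < g y :=
    (h.continuousOn.continuousAt (h.isOpen.mem_nhds hx)).eventually (lt_mem_nhds (not_le.1 hc))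
  obtain ⟨y, ⟨hy0, hyU⟩, hyΩ⟩ :=
    mem_closure_iff_nhds.1 hxc _ (h1.and (h.isOpen.mem_nhds hx))
  exact lt_asymm hy0 ((h.mem_iff y hyU).1 hyΩ)

theorem sub_smul_mem (h : IsConeSublevel Ω U ν η g) (hν : ‖ν‖ = 1) (hη : η < 1) {x : E}
    (hx : x ∈ U) (hxc : x ∈ closure Ω) {t : ℝ} (ht : 0 < t) (hxt : x - t • ν ∈ U) :
    x - t • ν ∈ Ω :=
  (h.mem_iff _ hxt).2 ((h.sub_smul_lt hν hη hx ht hxt).trans_le (h.le_of_mem_closure hx hxc))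

theorem mem_frontier_iff (h : IsConeSublevel Ω U ν η g) (hν : ‖ν‖ = 1) (hη : η < 1)
    (hΩ : IsOpen Ω) {x : E} (hx : x ∈ U) : x ∈ frontier Ω ↔ g x = 0 := by
  rw [hΩ.frontier_eq]
  constructor
  · rintro ⟨h1, h2⟩
    exact le_antisymm (h.le_of_mem_closure hx h1)
      (not_lt.1 fun h3 => h2 ((h.mem_iff x hx).2 h3))
  · intro h0
    refine ⟨?_, fun h2 => ((h.mem_iff x hx).1 h2).ne h0⟩
    have hc : Continuous (fun t : ℝ => x - t • ν) := by fun_prop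
    have hlim : Tendsto (fun t : ℝ => x - t • ν) (𝓝[>] 0) (𝓝 x) := by
      simpa using hc.continuousAt.tendsto.mono_left (nhdsWithin_le_nhds (a := (0 : ℝ)))
    refine mem_closure_of_tendsto hlim ?_
    filter_upwards [h.eventually_sub_smul_mem hx, self_mem_nhdsWithin] with t ht ht0
    exact (h.mem_iff _ ht).2 (h0 ▸ h.sub_smul_lt hν hη hx ht0 ht)

theorem abs_inner_le (h : IsConeSublevel Ω U ν η g) (hν : ‖ν‖ = 1) (hη : η < 1)
    (hΩ : IsOpen Ω) {x x' : E} (hx : x ∈ frontier Ω ∩ U) (hx' : x' ∈ frontier Ω ∩ U) :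
    |inner ℝ ν (x' - x)| ≤ η * ‖x' - x‖ := by
  have e1 := (h.mem_frontier_iff hν hη hΩ hx.2).1 hx.1
  have e2 := (h.mem_frontier_iff hν hη hΩ hx'.2).1 hx'.1
  rw [abs_le]
  constructor
  · by_contra hc
    have := h.lt_of_cone x' hx'.2 x hx.2 (by
      rw [norm_sub_rev, ← neg_sub x' x, inner_neg_right]
      linarith)
    linarith
  · by_contra hc
    have := h.lt_of_cone x hx.2 x' hx'.2 (not_le.1 hc)
    linarith
end IsConeSublevel

/-- The projection onto the hyperplane orthogonal to `ν` along the direction `e`. -/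
noncomputable def obliqueProjection (ν e : E) : E →L[ℝ] (ℝ ∙ ν)ᗮ :=
  (ℝ ∙ ν)ᗮ.orthogonalProjectionOnto ∘L
    (ContinuousLinearMap.id ℝ E - ((inner ℝ ν e)⁻¹ • innerSL ℝ ν).smulRight e)

theorem coe_obliqueProjection {ν e : E} (he : inner ℝ ν e ≠ 0) (x : E) :
    (obliqueProjection ν e x : E) = x - ((inner ℝ ν e)⁻¹ * inner ℝ ν x) • e := by
  have hmem : x - ((inner ℝ ν e)⁻¹ * inner ℝ ν x) • e ∈ (ℝ ∙ ν)ᗮ := by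
    rw [Submodule.mem_orthogonal_singleton_iff_inner_right, inner_sub_right, inner_smul_right]
    field_simp
    simp
  have : obliqueProjection ν e x = (ℝ ∙ ν)ᗮ.orthogonalProjectionOnto
      (x - ((inner ℝ ν e)⁻¹ * inner ℝ ν x) • e) := by
    simp [obliqueProjection]
  rw [this]
  exact Submodule.starProjection_eq_self_iff.2 hmem

theorem obliqueProjection_add_smul {ν e : E} (he : inner ℝ ν e ≠ 0) (y : (ℝ ∙ ν)ᗮ) (s : ℝ) :
    obliqueProjection ν e (y + s • e) = y := by
  have h0 : inner ℝ ν (y : E) = 0 := Submodule.mem_orthogonal_singleton_iff_inner_right.1 y.2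
  ext
  rw [coe_obliqueProjection he, inner_add_right, h0, inner_smul_right, zero_add, mul_left_comm,
    inv_mul_cancel₀ he]
  simp

/-- The chords of the boundary are almost orthogonal to `ν`, so that the projection along a
transversal direction hardly changes their length. -/
theorem IsConeSublevel.nearIsometryOn {Ω U : Set E} {ν : E} {η : ℝ} {g : E → ℝ}
    (h : IsConeSublevel Ω U ν η g) (hν : ‖ν‖ = 1) (hη0 : 0 ≤ η) (hη : η < 1) (hΩ : IsOpen Ω)
    {e : E} (he : 1 / 2 ≤ inner ℝ ν e) (hen : ‖e‖ ≤ 2) :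
    NearIsometryOn (obliqueProjection ν e) (frontier Ω ∩ U) (4 * η) := by
  intro x hx x' hx'
  have h1 := h.abs_inner_le hν hη hΩ hx' hx
  have h2 : ‖((inner ℝ ν e)⁻¹ * inner ℝ ν (x - x')) • e‖ ≤ 4 * η * ‖x - x'‖ := by
    rw [norm_smul, norm_mul, norm_inv, Real.norm_of_nonneg (by linarith), Real.norm_eq_abs]
    have h3 : (inner ℝ ν e)⁻¹ ≤ 2 := by
      rw [inv_le_comm₀ (by linarith) (by norm_num)]
      linarith
    calc _ ≤ 2 * (η * ‖x - x'‖) * 2 := by gcongr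
      _ = _ := by ring
  have h4 : dist (obliqueProjection ν e x) (obliqueProjection ν e x') =
      ‖(x - x') - ((inner ℝ ν e)⁻¹ * inner ℝ ν (x - x')) • e‖ := by
    rw [dist_eq_norm, ← map_sub, ← coe_obliqueProjection (by linarith)]
    rfl
  rw [h4, dist_eq_norm]
  have h5 := norm_sub_le (x - x') (((inner ℝ ν e)⁻¹ * inner ℝ ν (x - x')) • e)
  have h6 := norm_sub_norm_le (x - x') (((inner ℝ ν e)⁻¹ * inner ℝ ν (x - x')) • e)
  constructor <;> linarith

/-! ### The fundamental theorem of calculus on lines -/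

section line
variable {Ω U : Set E} {ν e : E} {η : ℝ} {g u : E → ℝ}

theorem isClosedEmbedding_line (y : E) (he : e ≠ 0) :
    IsClosedEmbedding (fun s : ℝ => y + s • e) :=
  (Homeomorph.addLeft y).isClosedEmbedding.comp (isClosedEmbedding_smul_left he)

theorem tendsto_comp_line (hcs : HasCompactSupport u) (he : e ≠ 0) (y : E) :
    Tendsto (fun s : ℝ => u (y + s • e)) atBot (𝓝 0) ∧
    Tendsto (fun s : ℝ => u (y + s • e)) atTop (𝓝 0) := by
  have h1 : HasCompactSupport (fun s : ℝ => u (y + s • e)) :=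
    hcs.comp_isClosedEmbedding (isClosedEmbedding_line y he)
  exact ⟨h1.is_zero_at_infty.mono_left _root_.atBot_le_cocompact,
    h1.is_zero_at_infty.mono_left _root_.atTop_le_cocompact⟩

theorem hasDerivAt_line (hu : ∀ x ∈ Ω, DifferentiableAt ℝ u x) {y : E} {s : ℝ}
    (hs : y + s • e ∈ tsupport u → y + s • e ∈ Ω) :
    HasDerivAt (fun s : ℝ => u (y + s • e)) (fderiv ℝ u (y + s • e) e) s := by
  have hd : DifferentiableAt ℝ u (y + s • e) := by
    by_cases hm : y + s • e ∈ tsupport u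
    · exact hu _ (hs hm)
    · exact (differentiableAt_const (0 : ℝ)).congr_of_eventuallyEq
        (notMem_tsupport_iff_eventuallyEq.1 hm)
  have h2 : HasDerivAt (fun s : ℝ => y + s • e) e s := by
    simpa using ((hasDerivAt_id s).smul_const e).const_add y
  exact hd.hasFDerivAt.comp_hasDerivAt s h2

theorem fderiv_apply_eq_zero_of_notMem_tsupport {x : E} (hx : x ∉ tsupport u) :
    fderiv ℝ u x e = 0 := by
  rw [show fderiv ℝ u x = 0 from Function.notMem_support.1 fun h => hx (support_fderiv_subset ℝ h)]
  rfl

/-- The part in `Ω` of a line that meets the boundary in `U` ends there, so that the integral of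
the derivative along it is the value at the boundary point. -/
theorem IsConeSublevel.integral_line_eq (h : IsConeSublevel Ω U ν η g) (hν : ‖ν‖ = 1)
    (hη : η < 1) (hΩ : IsOpen Ω) (he : η * ‖e‖ < inner ℝ ν e) (he0 : e ≠ 0)
    (hcs : HasCompactSupport u) (hsub : tsupport u ⊆ U) (hc : ContinuousOn u (closure Ω))
    (hu : ∀ x ∈ Ω, DifferentiableAt ℝ u x) {y : E} {s₀ : ℝ}
    (hs₀ : y + s₀ • e ∈ frontier Ω ∩ U)
    (hint : Integrable fun s : ℝ => Ω.indicator (fun x => fderiv ℝ u x e) (y + s • e)) :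
    ∫ s : ℝ, Ω.indicator (fun x => fderiv ℝ u x e) (y + s • e) = u (y + s₀ • e) := by
  have hg0 := (h.mem_frontier_iff hν hη hΩ hs₀.2).1 hs₀.1
  have hmem : ∀ s, y + s • e ∈ U → s < s₀ → y + s • e ∈ Ω := fun s hs hlt => by
    rw [h.mem_iff _ hs, ← hg0]
    exact h.lt_of_sub_eq_smul he hs hs₀.2 (sub_pos.2 hlt) (by module)
  have hnot : ∀ s, y + s • e ∈ U → s₀ ≤ s → y + s • e ∉ Ω := fun s hs hle => by
    rw [h.mem_iff _ hs, not_lt, ← hg0]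
    rcases hle.eq_or_lt with rfl | hlt
    · exact le_rfl
    · exact (h.lt_of_sub_eq_smul he hs₀.2 hs (sub_pos.2 hlt) (by module)).le
  have hind : (fun s : ℝ => Ω.indicator (fun x => fderiv ℝ u x e) (y + s • e)) =
      (Iio s₀).indicator (fun s => fderiv ℝ u (y + s • e) e) := by
    ext s
    by_cases hm : y + s • e ∈ tsupport u
    · rcases lt_or_ge s s₀ with hlt | hle
      · rw [indicator_of_mem (hmem s (hsub hm) hlt), indicator_of_mem (mem_Iio.2 hlt)]
      · rw [indicator_of_notMem (hnot s (hsub hm) hle), indicator_of_notMem (by simpa using hle)]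
    · simp [indicator, fderiv_apply_eq_zero_of_notMem_tsupport hm]
  rw [hind] at hint ⊢
  rw [integrable_indicator_iff measurableSet_Iio] at hint
  rw [integral_indicator measurableSet_Iio, ← integral_Iic_eq_integral_Iio]
  have hcont : ContinuousWithinAt (fun s : ℝ => u (y + s • e)) (Iic s₀) s₀ := by
    have hl : Continuous (fun s : ℝ => y + s • e) := by fun_prop
    have h1 : ContinuousWithinAt u (closure Ω) (y + s₀ • e) :=
      hc _ (frontier_subset_closure hs₀.1)
    have hU : ∀ᶠ s in 𝓝 s₀, y + s • e ∈ U :=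
      hl.continuousAt.eventually (h.isOpen.mem_nhds hs₀.2)
    refine Tendsto.comp (g := u) (f := fun s : ℝ => y + s • e) h1 ?_
    refine tendsto_nhdsWithin_iff.2 ⟨hl.continuousAt.tendsto.mono_left nhdsWithin_le_nhds, ?_⟩
    filter_upwards [nhdsWithin_le_nhds hU, self_mem_nhdsWithin] with s hs hle
    rcases (mem_Iic.1 hle).eq_or_lt with rfl | hlt
    · exact frontier_subset_closure hs₀.1
    · exact subset_closure (hmem s hs hlt)
  have := integral_Iic_of_hasDerivAt_of_tendsto hcont
    (fun s hs => hasDerivAt_line hu fun hm => hmem s (hsub hm) hs)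
    ((integrableOn_Iic_iff_integrableOn_Iio).2 hint) (tendsto_comp_line hcs he0 y).1
  simpa using this

/-- A line that does not meet the boundary in `U` is, within `U`, either inside or outside `Ω`, so
that the integral of the derivative along it vanishes. -/
theorem IsConeSublevel.integral_line_eq_zero (h : IsConeSublevel Ω U ν η g) (hν : ‖ν‖ = 1)
    (hη : η < 1) (hΩ : IsOpen Ω) (he0 : e ≠ 0)
    (hcs : HasCompactSupport u) (hsub : tsupport u ⊆ U)
    (hu : ∀ x ∈ Ω, DifferentiableAt ℝ u x) {y : E}
    (hy : ∀ s : ℝ, y + s • e ∉ frontier Ω ∩ U)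
    (hint : Integrable fun s : ℝ => Ω.indicator (fun x => fderiv ℝ u x e) (y + s • e)) :
    ∫ s : ℝ, Ω.indicator (fun x => fderiv ℝ u x e) (y + s • e) = 0 := by
  have hl : Continuous (fun s : ℝ => y + s • e) := by fun_prop
  have hconv : Convex ℝ ((fun s : ℝ => y + s • e) ⁻¹' U) := by
    have h1 := h.convex.affine_preimage (AffineMap.lineMap y (y + e))
    have h2 : ⇑(AffineMap.lineMap (k := ℝ) y (y + e)) = fun s : ℝ => y + s • e := by
      ext s
      simp [AffineMap.lineMap_apply, add_comm]
    rwa [h2] at h1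
  by_cases hall : ∀ s : ℝ, y + s • e ∈ U → y + s • e ∈ Ω
  · have hind : (fun s : ℝ => Ω.indicator (fun x => fderiv ℝ u x e) (y + s • e)) =
        fun s => fderiv ℝ u (y + s • e) e := by
      ext s
      by_cases hm : y + s • e ∈ tsupport u
      · rw [indicator_of_mem (hall s (hsub hm))]
      · simp [indicator, fderiv_apply_eq_zero_of_notMem_tsupport hm]
    rw [hind] at hint ⊢
    have := integral_of_hasDerivAt_of_tendsto
      (fun s => hasDerivAt_line hu fun hm => hall s (hsub hm)) hint
      (tendsto_comp_line hcs he0 y).1 (tendsto_comp_line hcs he0 y).2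
    simpa using this
  · push Not at hall
    obtain ⟨s₁, hs₁, hs₁'⟩ := hall
    have hnone : ∀ s : ℝ, y + s • e ∈ U → y + s • e ∉ Ω := by
      intro s hs hsΩ
      have h1 := (h.mem_iff _ hs).1 hsΩ
      have h2 : 0 ≤ g (y + s₁ • e) := not_lt.1 fun h3 => hs₁' ((h.mem_iff _ hs₁).2 h3)
      have hco : ContinuousOn (fun s : ℝ => g (y + s • e)) ((fun s : ℝ => y + s • e) ⁻¹' U) :=
        h.continuousOn.comp hl.continuousOn fun _ => id
      obtain ⟨s₂, hs₂, h4⟩ := hconv.isPreconnected.intermediate_value (a := s) (b := s₁) hs hs₁ hco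
        ⟨h1.le, h2⟩
      exact hy s₂ ⟨(h.mem_frontier_iff hν hη hΩ hs₂).2 h4, hs₂⟩
    have hind : (fun s : ℝ => Ω.indicator (fun x => fderiv ℝ u x e) (y + s • e)) = 0 := by
      ext s
      by_cases hm : y + s • e ∈ tsupport u
      · rw [indicator_of_notMem (hnone s (hsub hm))]
        rfl
      · simp [indicator, fderiv_apply_eq_zero_of_notMem_tsupport hm]
    rw [hind]
    simp
end line
end

section
variable {E : Type*} [NormedAddCommGroup E] [InnerProductSpace ℝ E] [FiniteDimensional ℝ E]
  [MeasurableSpace E] [BorelSpace E] {Ω U : Set E} {ν e : E} {η δ : ℝ} {g u : E → ℝ} {n : ℕ}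

/-- The integral of the derivative in a direction `e` transversal to the boundary is almost
`⟪ν, e⟫` times the surface integral of the boundary values. -/
theorem IsConeSublevel.abs_integral_fderiv_sub_le (h : IsConeSublevel Ω U ν η g) (hν : ‖ν‖ = 1)
    (hn : finrank ℝ E = n + 1) (hη0 : 0 ≤ η) (hη : η < 1 / 8) (hδ0 : 0 ≤ δ) (hδ : δ < 1)
    (hδ₁ : (1 + 4 * η) ^ n ≤ 1 + δ) (hδ₂ : 1 - δ ≤ (1 - 4 * η) ^ n) (hΩ : IsOpen Ω)
    (he : 1 / 2 ≤ inner ℝ ν e) (hen : ‖e‖ ≤ 2)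
    (hcs : HasCompactSupport u) (hsub : tsupport u ⊆ U) (hc : ContinuousOn u (closure Ω))
    (hu : ∀ x ∈ Ω, DifferentiableAt ℝ u x) (hint : IntegrableOn (fun x => fderiv ℝ u x e) Ω) :
    |(∫ x in Ω, fderiv ℝ u x e) - inner ℝ ν e * ∫ x in frontier Ω ∩ U, u x ∂μHE[n]| ≤
      2 * δ * ∫ x in frontier Ω ∩ U, |u x| ∂μHE[n] := by
  have hepos : 0 < inner ℝ ν e := by linarith
  have he0 : e ≠ 0 := by
    rintro rfl
    simp at hepos
  have hcone : η * ‖e‖ < inner ℝ ν e := by nlinarith [norm_nonneg e]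
  have hηl : η < 1 := by linarith
  set M := frontier Ω ∩ U with hM
  have hMm : MeasurableSet M := isClosed_frontier.measurableSet.inter h.isOpen.measurableSet
  set q := obliqueProjection ν e with hq
  have hqm : Measurable q := q.continuous.measurable
  have hiso : NearIsometryOn q M (4 * η) := h.nearIsometryOn hν hη0 hηl hΩ he hen
  have hP : (volume : Measure (ℝ ∙ ν)ᗮ) = μHE[n] := by
    have hfin : finrank ℝ (ℝ ∙ ν)ᗮ = n := by
      have : Fact (finrank ℝ E = n + 1) := ⟨hn⟩
      exact Submodule.finrank_orthogonal_span_singleton (norm_ne_zero_iff.1 (by simp [hν]))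
    rw [← InnerProductSpace.euclideanHausdorffMeasure_eq_volume, hfin]
  set f : E → ℝ := Ω.indicator fun x => fderiv ℝ u x e with hf
  have hfi : Integrable f := (integrable_indicator_iff hΩ.measurableSet).2 hint
  have hprod := integrable_oblique_coordinates hν hepos hfi
  -- `v y` is the boundary value of `u` on the line through `y` in direction `e`
  set v : (ℝ ∙ ν)ᗮ → ℝ := fun y => ∫ s : ℝ, f (y + s • e) with hv
  have hvi : Integrable v := hprod.integral_prod_left
  have hae := hprod.prod_right_ae
  have hvM : ∀ᵐ y : (ℝ ∙ ν)ᗮ, (∀ x ∈ M, q x = y → v y = u x) ∧ (y ∉ q '' M → v y = 0) := by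
    filter_upwards [hae] with y hy
    constructor
    · rintro x hx rfl
      have hx' : x = (q x : E) + ((inner ℝ ν e)⁻¹ * inner ℝ ν x) • e := by
        rw [hq, coe_obliqueProjection hepos.ne']
        abel
      rw [hx'] at hx
      have := h.integral_line_eq hν hηl hΩ hcone he0 hcs hsub hc hu hx hy
      rw [← hx'] at this
      exact this
    · intro hyM
      refine h.integral_line_eq_zero hν hηl hΩ he0 hcs hsub hu (fun s hs => hyM ⟨_, hs, ?_⟩) hy
      exact obliqueProjection_add_smul hepos.ne' y s
  have h1 : ∫ x in Ω, fderiv ℝ u x e = inner ℝ ν e * ∫ y in q '' M, v y := by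
    rw [← integral_indicator hΩ.measurableSet, integral_eq_oblique_coordinates hν hepos hfi,
      setIntegral_eq_integral_of_ae_compl_eq_zero (hvM.mono fun y hy => hy.2)]
  have hle₁ := hiso.le_restrict_image (by linarith) hqm hδ₂
  have hle₂ := hiso.restrict_image_le (by linarith) hqm hδ₁
  rw [← hP] at hle₁ hle₂
  set ρ := ((μHE[n] : Measure E).restrict M).map q with hρ
  have hpos : ENNReal.ofReal (1 - δ) ≠ 0 := by simpa using hδ
  have hac : ρ ≪ volume :=
    (absolutelyContinuous_smul hpos).trans
      ((absolutelyContinuous_of_le hle₁).trans restrict_le_self.absolutelyContinuous)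
  have hvρ : Integrable v ρ := by
    have h2 : Integrable v (ENNReal.ofReal (1 - δ) • ρ) := hvi.restrict.mono_measure hle₁
    exact (integrable_smul_measure hpos ENNReal.ofReal_ne_top).1 h2
  have hvu : ∀ᵐ x ∂(μHE[n] : Measure E).restrict M, v (q x) = u x := by
    filter_upwards [ae_of_ae_map hqm.aemeasurable (hac.ae_le hvM), ae_restrict_mem hMm] with x hx hxM
    exact hx.1 x hxM rfl
  have h3 := abs_integral_sub_le_of_measure_le hle₁ hle₂ hvρ hδ0 hδ.le
  rw [hρ, integral_map hqm.aemeasurable hvρ.aestronglyMeasurable,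
    integral_map hqm.aemeasurable hvρ.abs.aestronglyMeasurable,
    integral_congr_ae hvu, integral_congr_ae (hvu.mono fun x hx => congrArg abs hx)] at h3
  rw [h1, ← mul_sub, abs_mul, abs_of_pos hepos]
  have h4 : inner ℝ ν e ≤ 2 := (real_inner_le_norm ν e).trans (by rw [hν]; linarith)
  calc _ ≤ 2 * (δ * ∫ x in M, |u x| ∂μHE[n]) := by gcongr
    _ = _ := by ring
end

/-! ### Regular and singular boundary points -/

section
variable {d : ℕ} {Ω : Set (EuclideanSpace ℝ (Fin d))}

theorem IsOutwardUnitNormal.norm_eq_one {x ν : EuclideanSpace ℝ (Fin d)}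
    (h : IsOutwardUnitNormal Ω x ν) : ‖ν‖ = 1 := by
  obtain ⟨U, g, -, -, -, -, hg0, -, rfl⟩ := h
  exact norm_smul_inv_norm (𝕜 := ℝ) hg0

theorem IsOutwardUnitNormal.outwardUnitNormal_eq {x ν : EuclideanSpace ℝ (Fin d)}
    (h : IsOutwardUnitNormal Ω x ν) : outwardUnitNormal Ω x = ν := by
  have hex : ∃ ν, IsOutwardUnitNormal Ω x ν := ⟨ν, h⟩
  rw [outwardUnitNormal, dif_pos hex]
  exact hex.choose_spec.unique h

theorem norm_outwardUnitNormal_le (x : EuclideanSpace ℝ (Fin d)) :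
    ‖outwardUnitNormal Ω x‖ ≤ 1 := by
  by_cases hex : ∃ ν, IsOutwardUnitNormal Ω x ν
  · obtain ⟨ν, hν⟩ := hex
    rw [hν.outwardUnitNormal_eq, hν.norm_eq_one]
  · rw [outwardUnitNormal, dif_neg hex, norm_zero]
    exact zero_le_one

theorem continuousOn_gradient {U : Set (EuclideanSpace ℝ (Fin d))}
    {g : EuclideanSpace ℝ (Fin d) → ℝ} (hU : IsOpen U) (hg : ContDiffOn ℝ ∞ g U) :
    ContinuousOn (gradient g) U :=
  (InnerProductSpace.toDual ℝ _).symm.continuous.comp_continuousOn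
    (hg.continuousOn_fderiv_of_isOpen hU (by simp))

theorem eq_zero_of_mem_frontier (hΩ : IsOpen Ω) {U : Set (EuclideanSpace ℝ (Fin d))}
    {g : EuclideanSpace ℝ (Fin d) → ℝ} (hU : IsOpen U) (hg : ContinuousOn g U)
    (hgΩ : ∀ y ∈ U, y ∈ Ω ↔ g y < 0) {y : EuclideanSpace ℝ (Fin d)} (hyU : y ∈ U)
    (hy : y ∈ frontier Ω) : g y = 0 := by
  rw [hΩ.frontier_eq] at hy
  refine le_antisymm ?_ (not_lt.1 fun h => hy.2 ((hgΩ y hyU).2 h))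
  by_contra hc
  have h1 : ∀ᶠ z in 𝓝 y, 0 < g z :=
    (hg.continuousAt (hU.mem_nhds hyU)).eventually (lt_mem_nhds (not_le.1 hc))
  obtain ⟨z, ⟨hz0, hzU⟩, hzΩ⟩ := mem_closure_iff_nhds.1 hy.1 _ (h1.and (hU.mem_nhds hyU))
  exact lt_asymm hz0 ((hgΩ z hzU).1 hzΩ)

/-- One local defining function serves all boundary points nearby, so that the normal field is
locally a continuous normalized gradient. -/
theorem IsOutwardUnitNormal.exists_continuous_normal (hΩ : IsOpen Ω)
    {x ν : EuclideanSpace ℝ (Fin d)} (h : IsOutwardUnitNormal Ω x ν) :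
    ∃ N : EuclideanSpace ℝ (Fin d) → EuclideanSpace ℝ (Fin d), ContinuousAt N x ∧ N x = ν ∧
      ∀ᶠ y in 𝓝 x, y ∈ frontier Ω → IsOutwardUnitNormal Ω y (N y) := by
  obtain ⟨U, g, hU, hxU, hg, hgx, hg0, hgΩ, rfl⟩ := h
  have hc : ContinuousAt (gradient g) x :=
    (continuousOn_gradient hU hg).continuousAt (hU.mem_nhds hxU)
  refine ⟨fun y => ‖gradient g y‖⁻¹ • gradient g y,
    (hc.norm.inv₀ (norm_ne_zero_iff.2 hg0)).smul hc, rfl, ?_⟩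
  filter_upwards [hU.mem_nhds hxU, hc.eventually_ne hg0] with y hyU hy0 hyf
  exact ⟨U, g, hU, hyU, hg, eq_zero_of_mem_frontier hΩ hU hg.continuousOn hgΩ hyU hyf, hy0, hgΩ, rfl⟩

theorem IsOutwardUnitNormal.continuousWithinAt (hΩ : IsOpen Ω) {x ν : EuclideanSpace ℝ (Fin d)}
    (h : IsOutwardUnitNormal Ω x ν) :
    ContinuousWithinAt (outwardUnitNormal Ω) (frontier Ω) x := by
  obtain ⟨N, hN, hNx, hev⟩ := h.exists_continuous_normal hΩ
  refine (hN.continuousWithinAt (s := frontier Ω)).congr_of_eventuallyEq ?_ ?_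
  · filter_upwards [nhdsWithin_le_nhds hev, self_mem_nhdsWithin] with y hy hyf
    exact (hy hyf).outwardUnitNormal_eq
  · rw [h.outwardUnitNormal_eq, hNx]

/-- The singular part of the boundary, where there is no outward unit normal. -/
def singularBoundary (Ω : Set (EuclideanSpace ℝ (Fin d))) : Set (EuclideanSpace ℝ (Fin d)) :=
  {x | x ∈ frontier Ω ∧ ¬ ∃ ν, IsOutwardUnitNormal Ω x ν}

theorem isClosed_singularBoundary (hΩ : IsOpen Ω) : IsClosed (singularBoundary Ω) := by
  rw [← isOpen_compl_iff, isOpen_iff_mem_nhds]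
  intro x hx
  by_cases hxf : x ∈ frontier Ω
  · have hex : ∃ ν, IsOutwardUnitNormal Ω x ν := by
      by_contra hc
      exact hx ⟨hxf, hc⟩
    obtain ⟨ν, hν⟩ := hex
    obtain ⟨N, -, -, hev⟩ := hν.exists_continuous_normal hΩ
    filter_upwards [hev] with y hy hys
    exact hys.2 ⟨_, hy hys.1⟩
  · filter_upwards [isClosed_frontier.isOpen_compl.mem_nhds hxf] with y hy hys
    exact hy hys.1

theorem aestronglyMeasurable_outwardUnitNormal (hΩ : IsOpen Ω)
    (hS : μHE[d - 1] (singularBoundary Ω) = 0) :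
    AEStronglyMeasurable (outwardUnitNormal Ω) ((μHE[d - 1]).restrict (frontier Ω)) := by
  have h1 : ContinuousOn (outwardUnitNormal Ω) (frontier Ω \ singularBoundary Ω) := by
    rintro x ⟨hx, hxs⟩
    have hex : ∃ ν, IsOutwardUnitNormal Ω x ν := by
      by_contra hc
      exact hxs ⟨hx, hc⟩
    obtain ⟨ν, hν⟩ := hex
    exact (hν.continuousWithinAt hΩ).mono sdiff_subset
  have h2 := h1.aestronglyMeasurable (μ := μHE[d - 1])
    (isClosed_frontier.measurableSet.diff (isClosed_singularBoundary hΩ).measurableSet)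
  rwa [restrict_congr_set (sdiff_null_ae_eq_self hS)] at h2

/-- Near a regular boundary point, `Ω` is the region below a graph of arbitrarily small slope over
the tangent hyperplane. -/
theorem IsOutwardUnitNormal.exists_isConeSublevel (hΩ : IsOpen Ω)
    {x ν : EuclideanSpace ℝ (Fin d)} (h : IsOutwardUnitNormal Ω x ν) {η : ℝ} (hη : 0 < η) :
    ∃ r > 0, (∃ g, IsConeSublevel Ω (Metric.ball x r) ν η g) ∧
      ∀ y ∈ frontier Ω ∩ Metric.ball x r, ‖outwardUnitNormal Ω y - ν‖ ≤ η := by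
  have hN := h.continuousWithinAt hΩ
  have hNx := h.outwardUnitNormal_eq
  obtain ⟨U, g, hU, hxU, hg, hgx, hg0, hgΩ, hνe⟩ := h
  have hc : ContinuousAt (gradient g) x :=
    (continuousOn_gradient hU hg).continuousAt (hU.mem_nhds hxU)
  have hpos : 0 < ‖gradient g x‖ := norm_pos_iff.2 hg0
  have e1 : ∀ᶠ y in 𝓝 x, ‖gradient g y - gradient g x‖ ≤ η * ‖gradient g x‖ := by
    filter_upwards [Metric.continuousAt_iff'.1 hc _ (mul_pos hη hpos)] with y hy
    rw [← dist_eq_norm]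
    exact hy.le
  have e2 : ∀ᶠ y in 𝓝 x, y ∈ frontier Ω → ‖outwardUnitNormal Ω y - ν‖ ≤ η := by
    rw [← eventually_nhdsWithin_iff]
    filter_upwards [Metric.continuousWithinAt_iff'.1 hN η hη] with y hy
    rw [hNx, dist_eq_norm] at hy
    exact hy.le
  obtain ⟨r, hr, hball⟩ := Metric.eventually_nhds_iff_ball.1
    ((e1.and e2).and (hU.eventually_mem hxU))
  refine ⟨r, hr, ⟨g, Metric.isOpen_ball, convex_ball x r,
    hg.continuousOn.mono fun y hy => (hball y hy).2, fun y hy => hgΩ y (hball y hy).2, ?_⟩,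
    fun y hy => (hball y hy.2).1.2 hy.1⟩
  intro y hy z hz hyz
  obtain ⟨w, hw, hweq⟩ := domain_mvt (f := g) (f' := fun w => fderiv ℝ g w) (s := Metric.ball x r)
    (x := y) (y := z)
    (fun w hw => ((hg.contDiffAt (hU.mem_nhds (hball w hw).2)).differentiableAt
      (by simp)).hasFDerivAt.hasFDerivWithinAt) (convex_ball x r) hy hz
  have hwb := (convex_ball x r).segment_subset hy hz hw
  have e3 : fderiv ℝ g w (z - y) = inner ℝ (gradient g w) (z - y) := by
    rw [gradient, InnerProductSpace.toDual_symm_apply]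
  have e4 : gradient g x = ‖gradient g x‖ • ν := by
    rw [hνe, smul_smul, mul_inv_cancel₀ hpos.ne', one_smul]
  have e5 : inner ℝ (gradient g w) (z - y) = inner ℝ (gradient g w - gradient g x) (z - y) +
      ‖gradient g x‖ * inner ℝ ν (z - y) := by
    rw [inner_sub_left, ← real_inner_smul_left, ← e4]
    ring
  have e6 := abs_le.1 (abs_real_inner_le_norm (gradient g w - gradient g x) (z - y))
  have e7 : ‖gradient g w - gradient g x‖ * ‖z - y‖ ≤ η * ‖gradient g x‖ * ‖z - y‖ := by
    gcongr
    exact (hball w hwb).1.1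
  have e8 := mul_lt_mul_of_pos_left hyz hpos
  rw [e3, e5] at hweq
  nlinarith [e6.1]
end

/-! ### The flux through a nearly flat piece of the boundary -/

section
variable {d : ℕ}

theorem fderiv_coord_apply {V : EuclideanSpace ℝ (Fin d) → EuclideanSpace ℝ (Fin d)}
    {x : EuclideanSpace ℝ (Fin d)} (hV : DifferentiableAt ℝ V x) (i : Fin d)
    (e : EuclideanSpace ℝ (Fin d)) :
    fderiv ℝ (fun y => V y i) x e = (fderiv ℝ V x e) i := by
  have h := ((EuclideanSpace.proj i : EuclideanSpace ℝ (Fin d) →L[ℝ] ℝ).hasFDerivAt.comp x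
    hV.hasFDerivAt).fderiv
  rw [show (fun y => V y i) = (EuclideanSpace.proj i : EuclideanSpace ℝ (Fin d) →L[ℝ] ℝ) ∘ V from rfl,
    h]
  rfl

/-- Along one coordinate direction, the flux estimate is the difference of those for `ν + e / 2`
and `ν`, both of which are transversal to the boundary. -/
theorem IsConeSublevel.abs_integral_partialDeriv_sub_le {Ω U : Set (EuclideanSpace ℝ (Fin d))}
    {ν : EuclideanSpace ℝ (Fin d)} {η δ : ℝ} {g u : EuclideanSpace ℝ (Fin d) → ℝ}
    (h : IsConeSublevel Ω U ν η g) (hν : ‖ν‖ = 1)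
    (hd : 0 < d) (hη0 : 0 ≤ η) (hη : η < 1 / 8) (hδ0 : 0 ≤ δ) (hδ : δ < 1)
    (hδ₁ : (1 + 4 * η) ^ (d - 1) ≤ 1 + δ) (hδ₂ : 1 - δ ≤ (1 - 4 * η) ^ (d - 1)) (hΩ : IsOpen Ω)
    (hcs : HasCompactSupport u) (hsub : tsupport u ⊆ U) (hc : ContinuousOn u (closure Ω))
    (hu : ∀ x ∈ Ω, DifferentiableAt ℝ u x)
    (hint : ∀ e, IntegrableOn (fun x => fderiv ℝ u x e) Ω) (i : Fin d) :
    |(∫ x in Ω, fderiv ℝ u x (EuclideanSpace.single i 1)) -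
      ν i * ∫ x in frontier Ω ∩ U, u x ∂μHE[d - 1]| ≤
      8 * δ * ∫ x in frontier Ω ∩ U, |u x| ∂μHE[d - 1] := by
  have hn : finrank ℝ (EuclideanSpace ℝ (Fin d)) = (d - 1) + 1 := by
    rw [finrank_euclideanSpace_fin]
    omega
  set e₀ : EuclideanSpace ℝ (Fin d) := EuclideanSpace.single i 1 with he₀
  have hin : inner ℝ ν e₀ = ν i := by simp [he₀, EuclideanSpace.inner_single_right]
  have hνν : inner ℝ ν ν = (1 : ℝ) := by rw [real_inner_self_eq_norm_sq, hν, one_pow]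
  have hνi : |ν i| ≤ 1 := by
    rw [← hν, ← Real.norm_eq_abs]
    exact PiLp.norm_apply_le ν i
  have hne₀ : ‖e₀‖ = 1 := by simp [he₀]
  have hi₁ : inner ℝ ν (ν + (1 / 2 : ℝ) • e₀) = 1 + ν i / 2 := by
    rw [inner_add_right, inner_smul_right, hνν, hin]
    ring
  have h₁ := h.abs_integral_fderiv_sub_le (e := ν + (1 / 2 : ℝ) • e₀) hν hn hη0 hη hδ0 hδ hδ₁ hδ₂ hΩ
    (by rw [hi₁]; linarith [(abs_le.1 hνi).1])
    (by
      refine (norm_add_le _ _).trans ?_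
      rw [hν, norm_smul, hne₀]
      norm_num) hcs hsub hc hu (hint _)
  have h₂ := h.abs_integral_fderiv_sub_le (e := ν) hν hn hη0 hη hδ0 hδ hδ₁ hδ₂ hΩ
    (by rw [hνν]; norm_num) (by rw [hν]; norm_num) hcs hsub hc hu (hint _)
  have hsplit : ∫ x in Ω, fderiv ℝ u x (ν + (1 / 2 : ℝ) • e₀) =
      (∫ x in Ω, fderiv ℝ u x ν) + (1 / 2) * ∫ x in Ω, fderiv ℝ u x e₀ := by
    rw [← integral_const_mul, ← integral_add (hint _) ((hint _).const_mul _)]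
    simp
  rw [hsplit, hi₁] at h₁
  rw [hνν] at h₂
  rw [abs_le] at h₁ h₂ ⊢
  constructor <;> nlinarith [h₁.1, h₁.2, h₂.1, h₂.2]

/-- The flux estimate for fields with integrable partial derivatives. -/
theorem IsConeSublevel.abs_integral_divergence_sub_le_of_integrable
    {Ω U : Set (EuclideanSpace ℝ (Fin d))}
    {ν : EuclideanSpace ℝ (Fin d)} {η δ : ℝ} {g : EuclideanSpace ℝ (Fin d) → ℝ}
    {V : EuclideanSpace ℝ (Fin d) → EuclideanSpace ℝ (Fin d)}
    (h : IsConeSublevel Ω U ν η g) (hν : ‖ν‖ = 1)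
    (hd : 0 < d) (hη0 : 0 ≤ η) (hη : η < 1 / 8) (hδ0 : 0 ≤ δ) (hδ : δ < 1)
    (hδ₁ : (1 + 4 * η) ^ (d - 1) ≤ 1 + δ) (hδ₂ : 1 - δ ≤ (1 - 4 * η) ^ (d - 1)) (hΩ : IsOpen Ω)
    (hn : ∀ y ∈ frontier Ω ∩ U, ‖outwardUnitNormal Ω y - ν‖ ≤ δ)
    (hnm : AEStronglyMeasurable (outwardUnitNormal Ω) ((μHE[d - 1]).restrict (frontier Ω)))
    (hcs : HasCompactSupport V) (hsub : tsupport V ⊆ U) (hc : ContinuousOn V (closure Ω))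
    (hV : ∀ x ∈ Ω, DifferentiableAt ℝ V x)
    (hint : ∀ e, IntegrableOn (fun x => fderiv ℝ V x e) Ω)
    (hVM : IntegrableOn V (frontier Ω ∩ U) μHE[d - 1]) :
    |(∫ x in Ω, divergence V x) -
      ∫ x in frontier Ω ∩ U, inner ℝ (V x) (outwardUnitNormal Ω x) ∂μHE[d - 1]| ≤
      (8 * d + 1) * δ * ∫ x in frontier Ω ∩ U, ‖V x‖ ∂μHE[d - 1] := by
  set M := frontier Ω ∩ U with hM
  have hMm : MeasurableSet M := isClosed_frontier.measurableSet.inter h.isOpen.measurableSet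
  have hint' : ∀ (i : Fin d) e, IntegrableOn (fun x => fderiv ℝ (fun y => V y i) x e) Ω := by
    intro i e
    refine ((EuclideanSpace.proj i : EuclideanSpace ℝ (Fin d) →L[ℝ] ℝ).integrable_comp
      (hint e)).congr ?_
    filter_upwards [ae_restrict_mem hΩ.measurableSet] with x hx
    exact (fderiv_coord_apply (hV x hx) i e).symm
  have hVi : ∀ i : Fin d, Integrable (fun x => V x i) ((μHE[d - 1]).restrict M) := fun i =>
    (EuclideanSpace.proj i : EuclideanSpace ℝ (Fin d) →L[ℝ] ℝ).integrable_comp hVM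
  have hsubi : ∀ i : Fin d, tsupport (fun x => V x i) ⊆ tsupport V := fun i =>
    closure_mono fun x hx hVx => hx (by simp [hVx])
  have hcoord : ∀ i : Fin d, |(∫ x in Ω, (fderiv ℝ V x (EuclideanSpace.single i 1)) i) -
      ν i * ∫ x in M, V x i ∂μHE[d - 1]| ≤ 8 * δ * ∫ x in M, ‖V x‖ ∂μHE[d - 1] := by
    intro i
    have := h.abs_integral_partialDeriv_sub_le (u := fun x => V x i) hν hd hη0 hη hδ0 hδ hδ₁ hδ₂ hΩ
      (hcs.of_isClosed_subset (isClosed_tsupport _) (hsubi i)) ((hsubi i).trans hsub)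
      ((EuclideanSpace.proj i : EuclideanSpace ℝ (Fin d) →L[ℝ] ℝ).continuous.comp_continuousOn hc)
      (fun x hx => ((EuclideanSpace.proj i : EuclideanSpace ℝ (Fin d) →L[ℝ] ℝ).differentiableAt.comp
        x (hV x hx))) (hint' i) i
    rw [setIntegral_congr_fun hΩ.measurableSet
      (fun x hx => fderiv_coord_apply (hV x hx) i (EuclideanSpace.single i 1))] at this
    exact this.trans (mul_le_mul_of_nonneg_left (integral_mono (hVi i).abs hVM.norm
      fun x => PiLp.norm_apply_le (V x) i) (by positivity))
  have hdiv : ∫ x in Ω, divergence V x =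
      ∑ i, ∫ x in Ω, (fderiv ℝ V x (EuclideanSpace.single i 1)) i := by
    simp only [divergence]
    exact integral_finsetSum _ fun i _ =>
      (EuclideanSpace.proj i : EuclideanSpace ℝ (Fin d) →L[ℝ] ℝ).integrable_comp (hint _)
  have hflux : ∫ x in M, inner ℝ (V x) ν ∂μHE[d - 1] = ∑ i, ν i * ∫ x in M, V x i ∂μHE[d - 1] := by
    simp only [PiLp.inner_apply, RCLike.inner_apply, conj_trivial]
    rw [integral_finsetSum _ fun i _ => (hVi i).const_mul _]
    simp only [integral_const_mul]
  have e1 : |(∫ x in Ω, divergence V x) - ∫ x in M, inner ℝ (V x) ν ∂μHE[d - 1]| ≤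
      8 * d * δ * ∫ x in M, ‖V x‖ ∂μHE[d - 1] := by
    rw [hdiv, hflux, ← Finset.sum_sub_distrib]
    refine (Finset.abs_sum_le_sum_abs _ _).trans ((Finset.sum_le_sum fun i _ => hcoord i).trans ?_)
    simp only [Finset.sum_const, Finset.card_univ, Fintype.card_fin, nsmul_eq_mul]
    exact le_of_eq (by ring)
  have hnm' : AEStronglyMeasurable (outwardUnitNormal Ω) ((μHE[d - 1]).restrict M) :=
    hnm.mono_measure (restrict_mono inter_subset_left le_rfl)
  have hi1 : Integrable (fun x => inner ℝ (V x) (outwardUnitNormal Ω x)) ((μHE[d - 1]).restrict M) :=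
    hVM.norm.mono (hVM.aestronglyMeasurable.inner hnm') (Eventually.of_forall fun x => by
      rw [norm_norm]
      refine (norm_inner_le_norm _ _).trans ?_
      exact mul_le_of_le_one_right (norm_nonneg _) (norm_outwardUnitNormal_le x))
  have hi2 : Integrable (fun x => inner ℝ (V x) ν) ((μHE[d - 1]).restrict M) :=
    hVM.inner_const ν
  have e2 : |(∫ x in M, inner ℝ (V x) ν ∂μHE[d - 1]) -
      ∫ x in M, inner ℝ (V x) (outwardUnitNormal Ω x) ∂μHE[d - 1]| ≤
      δ * ∫ x in M, ‖V x‖ ∂μHE[d - 1] := by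
    rw [← integral_sub hi2 hi1, ← integral_const_mul, ← Real.norm_eq_abs]
    refine norm_integral_le_of_norm_le (hVM.norm.const_mul _) ?_
    filter_upwards [ae_restrict_mem hMm] with x hx
    rw [← inner_sub_right]
    refine (norm_inner_le_norm _ _).trans ?_
    rw [mul_comm, norm_sub_rev]
    gcongr
    exact hn x hx
  calc _ ≤ _ := abs_sub_le _ (∫ x in M, inner ℝ (V x) ν ∂μHE[d - 1]) _
    _ ≤ _ := add_le_add e1 e2
    _ = _ := by ring

theorem divergence_comp_sub (V : EuclideanSpace ℝ (Fin d) → EuclideanSpace ℝ (Fin d))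
    (a x : EuclideanSpace ℝ (Fin d)) :
    divergence (fun y => V (y - a)) x = divergence V (x - a) := by
  simp only [divergence, fderiv_comp_sub]

theorem divergence_eq_zero_of_notMem_tsupport
    {V : EuclideanSpace ℝ (Fin d) → EuclideanSpace ℝ (Fin d)} {x : EuclideanSpace ℝ (Fin d)}
    (hx : x ∉ tsupport V) : divergence V x = 0 := by
  simp [divergence, show fderiv ℝ V x = 0 from
    Function.notMem_support.1 fun h => hx (support_fderiv_subset ℝ h)]

/-- The flux estimate when only the divergence is integrable: the field is shifted in the direction
`ν`, which makes it continuously differentiable up to the boundary. -/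
theorem IsConeSublevel.abs_integral_divergence_sub_le
    {Ω U : Set (EuclideanSpace ℝ (Fin d))}
    {ν : EuclideanSpace ℝ (Fin d)} {η δ : ℝ} {g : EuclideanSpace ℝ (Fin d) → ℝ}
    {V : EuclideanSpace ℝ (Fin d) → EuclideanSpace ℝ (Fin d)}
    (h : IsConeSublevel Ω U ν η g) (hν : ‖ν‖ = 1)
    (hd : 0 < d) (hη0 : 0 ≤ η) (hη : η < 1 / 8) (hδ0 : 0 ≤ δ) (hδ : δ < 1)
    (hδ₁ : (1 + 4 * η) ^ (d - 1) ≤ 1 + δ) (hδ₂ : 1 - δ ≤ (1 - 4 * η) ^ (d - 1)) (hΩ : IsOpen Ω)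
    (hn : ∀ y ∈ frontier Ω ∩ U, ‖outwardUnitNormal Ω y - ν‖ ≤ δ)
    (hnm : AEStronglyMeasurable (outwardUnitNormal Ω) ((μHE[d - 1]).restrict (frontier Ω)))
    (hfin : μHE[d - 1] (frontier Ω ∩ U) < ⊤)
    (hcs : HasCompactSupport V) (hsub : tsupport V ⊆ U) (hc : ContinuousOn V (closure Ω))
    (hV : ContDiffOn ℝ 1 V Ω) (hint : IntegrableOn (divergence V) Ω) :
    |(∫ x in Ω, divergence V x) -
      ∫ x in frontier Ω ∩ U, inner ℝ (V x) (outwardUnitNormal Ω x) ∂μHE[d - 1]| ≤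
      (8 * d + 1) * δ * ∫ x in frontier Ω ∩ U, ‖V x‖ ∂μHE[d - 1] := by
  set M := frontier Ω ∩ U with hM
  have hηl : η < 1 := by linarith
  have hMm : MeasurableSet M := isClosed_frontier.measurableSet.inter h.isOpen.measurableSet
  have hMc : M ⊆ closure Ω := inter_subset_left.trans frontier_subset_closure
  have hMfin : IsFiniteMeasure ((μHE[d - 1] : Measure (EuclideanSpace ℝ (Fin d))).restrict M) :=
    ⟨by rwa [restrict_apply_univ]⟩
  have hnm' : AEStronglyMeasurable (outwardUnitNormal Ω) ((μHE[d - 1]).restrict M) :=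
    hnm.mono_measure (restrict_mono inter_subset_left le_rfl)
  -- the support stays in `U` under small shifts
  have hev : ∀ᶠ t : ℝ in 𝓝[>] 0, ∀ x ∈ tsupport V, x + t • ν ∈ U := by
    obtain ⟨ρ, hρ, hsubρ⟩ := hcs.isCompact.exists_thickening_subset_open h.isOpen hsub
    filter_upwards [Ioo_mem_nhdsGT hρ] with t ht x hx
    refine hsubρ (Metric.mem_thickening_iff.2 ⟨x, hx, ?_⟩)
    rw [dist_eq_norm, add_sub_cancel_left, norm_smul, hν, Real.norm_of_nonneg ht.1.le, mul_one]
    exact ht.2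
  have hzero : ∀ x, x ∉ tsupport V → V x = 0 := fun x hx => image_eq_zero_of_notMem_tsupport hx
  obtain ⟨C, hC⟩ : ∃ C, ∀ x ∈ closure Ω, ‖V x‖ ≤ C := by
    obtain ⟨C, hC⟩ := (hcs.isCompact.inter_left isClosed_closure).exists_bound_of_continuousOn
      (hc.mono inter_subset_left)
    refine ⟨max C 0, fun x hx => ?_⟩
    by_cases hxs : x ∈ tsupport V
    · exact (hC x ⟨hx, hxs⟩).trans (le_max_left _ _)
    · rw [hzero x hxs, norm_zero]
      exact le_max_right _ _
  have hC0 : M.Nonempty → 0 ≤ C := fun ⟨x, hx⟩ => (norm_nonneg _).trans (hC x (hMc hx))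
  -- the shifted support meets the closure of `Ω` only in points that are shifted from `Ω`
  have hshift : ∀ᶠ t : ℝ in 𝓝[>] 0, ∀ x ∈ closure Ω, x - t • ν ∈ tsupport V → x - t • ν ∈ Ω := by
    filter_upwards [hev, self_mem_nhdsWithin] with t ht ht0 x hx hxs
    have hxU : x ∈ U := by simpa using ht _ hxs
    exact h.sub_smul_mem hν hηl hxU hx ht0 (hsub hxs)
  have hsmooth : ∀ᶠ t : ℝ in 𝓝[>] 0, ∀ x ∈ closure Ω,
      ContDiffAt ℝ 1 (fun y => V (y - t • ν)) x := by
    filter_upwards [hshift] with t ht x hx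
    have hsubt : ContDiffAt ℝ 1 (fun y : EuclideanSpace ℝ (Fin d) => y - t • ν) x := by fun_prop
    by_cases hxs : x - t • ν ∈ tsupport V
    · exact ContDiffAt.comp (g := V) x (hV.contDiffAt (hΩ.mem_nhds (ht x hx hxs))) hsubt
    · have h0 : ContDiffAt ℝ 1 V (x - t • ν) :=
        contDiffAt_const.congr_of_eventuallyEq (notMem_tsupport_iff_eventuallyEq.1 hxs)
      exact ContDiffAt.comp (g := V) x h0 hsubt
  have hptM : ∀ x ∈ M, Tendsto (fun t : ℝ => V (x - t • ν)) (𝓝[>] 0) (𝓝 (V x)) := by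
    intro x hx
    have hl : Continuous (fun t : ℝ => x - t • ν) := by fun_prop
    have hlim : Tendsto (fun t : ℝ => x - t • ν) (𝓝[>] 0) (𝓝 x) := by
      simpa using hl.continuousAt.tendsto.mono_left (nhdsWithin_le_nhds (a := (0 : ℝ)))
    refine Tendsto.comp (g := V) (hc x (hMc hx)) (tendsto_nhdsWithin_iff.2 ⟨hlim, ?_⟩)
    filter_upwards [h.eventually_sub_smul_mem hx.2, self_mem_nhdsWithin] with t ht ht0
    exact subset_closure (h.sub_smul_mem hν hηl hx.2 (hMc hx) ht0 ht)
  have hbdM : ∀ᶠ t : ℝ in 𝓝[>] 0, ∀ x ∈ M, ‖V (x - t • ν)‖ ≤ C := by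
    filter_upwards [hshift] with t ht x hx
    by_cases hxs : x - t • ν ∈ tsupport V
    · exact hC _ (subset_closure (ht x (hMc hx) hxs))
    · rw [hzero _ hxs, norm_zero]
      exact hC0 ⟨x, hx⟩
  have hmeasM : ∀ᶠ t : ℝ in 𝓝[>] 0,
      AEStronglyMeasurable (fun x => V (x - t • ν)) ((μHE[d - 1]).restrict M) := by
    filter_upwards [hsmooth] with t ht
    exact ContinuousOn.aestronglyMeasurable
      (fun x hx => (ht x (hMc hx)).continuousAt.continuousWithinAt) hMm
  have L2 : Tendsto (fun t : ℝ => ∫ x in M, inner ℝ (V (x - t • ν)) (outwardUnitNormal Ω x) ∂μHE[d - 1])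
      (𝓝[>] 0) (𝓝 (∫ x in M, inner ℝ (V x) (outwardUnitNormal Ω x) ∂μHE[d - 1])) := by
    refine tendsto_integral_filter_of_dominated_convergence (fun _ => C) ?_ ?_
      (integrable_const _) ?_
    · filter_upwards [hmeasM] with t ht
      exact ht.inner hnm'
    · filter_upwards [hbdM] with t ht
      filter_upwards [ae_restrict_mem hMm] with x hx
      refine (norm_inner_le_norm _ _).trans ?_
      exact (mul_le_of_le_one_right (norm_nonneg _) (norm_outwardUnitNormal_le x)).trans (ht x hx)
    · filter_upwards [ae_restrict_mem hMm] with x hx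
      exact (hptM x hx).inner tendsto_const_nhds
  have L3 : Tendsto (fun t : ℝ => ∫ x in M, ‖V (x - t • ν)‖ ∂μHE[d - 1])
      (𝓝[>] 0) (𝓝 (∫ x in M, ‖V x‖ ∂μHE[d - 1])) := by
    refine tendsto_integral_filter_of_dominated_convergence (fun _ => C) ?_ ?_
      (integrable_const _) ?_
    · filter_upwards [hmeasM] with t ht
      exact ht.norm
    · filter_upwards [hbdM] with t ht
      filter_upwards [ae_restrict_mem hMm] with x hx
      rw [norm_norm]
      exact ht x hx
    · filter_upwards [ae_restrict_mem hMm] with x hx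
      exact (hptM x hx).norm
  have L1 : Tendsto (fun t : ℝ => ∫ x in Ω, divergence (fun y => V (y - t • ν)) x)
      (𝓝[>] 0) (𝓝 (∫ x in Ω, divergence V x)) := by
    have hrw : ∀ t : ℝ, ∫ x in Ω, divergence (fun y => V (y - t • ν)) x =
        ∫ x, ((fun x => x + t • ν) ⁻¹' Ω).indicator (divergence V) x := by
      intro t
      rw [← integral_indicator hΩ.measurableSet,
        ← integral_sub_right_eq_self
          (((fun x => x + t • ν) ⁻¹' Ω).indicator (divergence V)) (t • ν)]
      congr 1
      ext x
      by_cases hx : x ∈ Ω <;> simp [indicator, hx, divergence_comp_sub]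
    simp only [hrw]
    rw [← integral_indicator hΩ.measurableSet]
    have hin : ∀ᶠ t : ℝ in 𝓝[>] 0, ((fun x : EuclideanSpace ℝ (Fin d) => x + t • ν) ⁻¹' Ω).indicator
        (divergence V) = ((fun x => x + t • ν) ⁻¹' Ω).indicator (Ω.indicator (divergence V)) := by
      filter_upwards [hev, self_mem_nhdsWithin] with t ht ht0
      ext x
      by_cases hxs : x ∈ tsupport V
      · by_cases hxΩ : x + t • ν ∈ Ω
        · have hx' : x ∈ Ω := by
            have := h.sub_smul_mem (x := x + t • ν) (t := t) hν hηl (ht x hxs) (subset_closure hxΩ)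
              ht0 (by simpa using hsub hxs)
            simpa using this
          simp [indicator, hxΩ, hx']
        · simp [indicator, hxΩ]
      · simp [indicator, divergence_eq_zero_of_notMem_tsupport hxs]
    have hI : Integrable (Ω.indicator (divergence V)) :=
      (integrable_indicator_iff hΩ.measurableSet).2 hint
    refine tendsto_integral_filter_of_dominated_convergence
      (fun x => ‖Ω.indicator (divergence V) x‖) ?_ ?_ hI.norm ?_
    · filter_upwards [hin] with t ht
      rw [ht]
      exact hI.aestronglyMeasurable.indicator
        ((hΩ.preimage (continuous_id.add continuous_const)).measurableSet)
    · filter_upwards [hin] with t ht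
      refine Eventually.of_forall fun x => ?_
      rw [ht]
      exact norm_indicator_le_norm_self _ _
    · refine Eventually.of_forall fun x => ?_
      have hl : Continuous (fun t : ℝ => x + t • ν) := by fun_prop
      by_cases hx : x ∈ Ω
      · have h0 : Ω ∈ 𝓝 ((fun t : ℝ => x + t • ν) 0) := by simpa using hΩ.mem_nhds hx
        have h1 : ∀ᶠ t : ℝ in 𝓝[>] 0, x + t • ν ∈ Ω :=
          (hl.continuousAt.eventually h0).filter_mono nhdsWithin_le_nhds
        refine tendsto_const_nhds.congr' ?_
        filter_upwards [h1] with t ht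
        simp [indicator, hx, ht]
      · refine tendsto_const_nhds.congr' ?_
        filter_upwards [hin] with t ht
        rw [ht]
        simp [indicator, hx]
  refine le_of_tendsto_of_tendsto (L1.sub L2).abs (L3.const_mul _) ?_
  filter_upwards [hev, hsmooth, hbdM, hmeasM] with t ht hts htb htm
  have hsupp : tsupport (fun y => V (y - t • ν)) = (fun y => y - t • ν) ⁻¹' tsupport V :=
    tsupport_comp_eq_preimage V (Homeomorph.subRight (t • ν))
  have hcst : HasCompactSupport (fun y => V (y - t • ν)) :=
    hcs.comp_homeomorph (Homeomorph.subRight (t • ν))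
  refine h.abs_integral_divergence_sub_le_of_integrable hν hd hη0 hη hδ0 hδ hδ₁ hδ₂ hΩ hn hnm hcst
    ?_ (fun x hx => (hts x hx).continuousAt.continuousWithinAt)
    (fun x hx => (hts x (subset_closure hx)).differentiableAt one_ne_zero) (fun e => ?_) ?_
  · rw [hsupp]
    intro x hx
    simpa using ht _ hx
  · have hce : ContinuousOn (fun x => fderiv ℝ (fun y => V (y - t • ν)) x e) (closure Ω) := fun x hx =>
      (((hts x hx).fderiv_right (m := 0) (by simp)).continuousAt.clm_apply
        continuousAt_const).continuousWithinAt
    have hK : IntegrableOn (fun x => fderiv ℝ (fun y => V (y - t • ν)) x e)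
        (closure Ω ∩ tsupport (fun y => V (y - t • ν))) :=
      (hce.mono inter_subset_left).integrableOn_compact (hcst.isCompact.inter_left isClosed_closure)
    refine (hK.of_forall_sdiff_eq_zero isClosed_closure.measurableSet ?_).mono_set subset_closure
    rintro x ⟨hx, hx'⟩
    rw [show fderiv ℝ (fun y => V (y - t • ν)) x = 0 from
      Function.notMem_support.1 fun hs => hx' ⟨hx, support_fderiv_subset ℝ hs⟩]
    rfl
  · refine (integrable_const C).mono' htm ?_
    filter_upwards [ae_restrict_mem hMm] with x hx
    exact htb x hx
end

/-! ### The Gauss–Green formula away from the singular part of the boundary -/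

section
variable {d : ℕ}

theorem divergence_smul {χ : EuclideanSpace ℝ (Fin d) → ℝ}
    {F : EuclideanSpace ℝ (Fin d) → EuclideanSpace ℝ (Fin d)} {x : EuclideanSpace ℝ (Fin d)}
    (hχ : DifferentiableAt ℝ χ x) (hF : DifferentiableAt ℝ F x) :
    divergence (fun y => χ y • F y) x = χ x * divergence F x + fderiv ℝ χ x (F x) := by
  have h1 : fderiv ℝ (fun y => χ y • F y) x = χ x • fderiv ℝ F x + (fderiv ℝ χ x).smulRight (F x) :=
    fderiv_fun_smul hχ hF
  have h2 : fderiv ℝ χ x (F x) = ∑ i, F x i * fderiv ℝ χ x (EuclideanSpace.single i 1) := by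
    conv_lhs => rw [← (EuclideanSpace.basisFun (Fin d) ℝ).sum_repr (F x)]
    simp
  simp only [divergence, h1, h2, Finset.mul_sum, ← Finset.sum_add_distrib]
  refine Finset.sum_congr rfl fun i _ => ?_
  simp [mul_comm]

theorem integral_divergence_eq_zero
    {V : EuclideanSpace ℝ (Fin d) → EuclideanSpace ℝ (Fin d)} (hV : ContDiff ℝ 1 V)
    (hcs : HasCompactSupport V) : ∫ x, divergence V x = 0 := by
  have hcont : ∀ e, Continuous fun x => fderiv ℝ V x e := fun e =>
    (hV.continuous_fderiv one_ne_zero).clm_apply continuous_const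
  have hcs' : ∀ e, HasCompactSupport fun x => fderiv ℝ V x e := fun e => hcs.fderiv_apply ℝ e
  have hint : ∀ e, Integrable fun x => fderiv ℝ V x e := fun e =>
    (hcont e).integrable_of_hasCompactSupport (hcs' e)
  have hproj : ∀ i : Fin d, Integrable fun x => (fderiv ℝ V x (EuclideanSpace.single i 1)) i :=
    fun i => (EuclideanSpace.proj i : EuclideanSpace ℝ (Fin d) →L[ℝ] ℝ).integrable_comp (hint _)
  simp only [divergence]
  rw [integral_finsetSum _ fun i _ => hproj i]
  refine Finset.sum_eq_zero fun i _ => ?_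
  have hd : Differentiable ℝ fun y => V y i := fun x =>
    (EuclideanSpace.proj i : EuclideanSpace ℝ (Fin d) →L[ℝ] ℝ).differentiableAt.comp x
      (hV.differentiable one_ne_zero x)
  have hi : Integrable fun y => V y i :=
    (EuclideanSpace.proj i : EuclideanSpace ℝ (Fin d) →L[ℝ] ℝ).integrable_comp
      (hV.continuous.integrable_of_hasCompactSupport hcs)
  have heq : ∀ x, (fderiv ℝ V x (EuclideanSpace.single i 1)) i =
      fderiv ℝ (fun y => V y i) x (EuclideanSpace.single i 1) := fun x =>
    (fderiv_coord_apply (hV.differentiable one_ne_zero x) i _).symm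
  have h := integral_mul_fderiv_eq_neg_fderiv_mul_of_integrable (𝕜 := ℝ)
    (μ := (volume : Measure (EuclideanSpace ℝ (Fin d))))
    (f := fun _ => (1 : ℝ)) (g := fun y => V y i) (v := EuclideanSpace.single i 1)
    (by simp) (by simpa [← heq] using hproj i) (by simpa using hi)
    (fun x _ => by simp) (fun x _ => hd x)
  simpa [← heq] using h

/-- The setting of the Gauss–Green theorem: a field on a domain with piecewise smooth boundary
that is continuous up to the boundary, continuously differentiable inside, and has an integrable
divergence. -/
structure IsFluxField (Ω : Set (EuclideanSpace ℝ (Fin d)))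
    (F : EuclideanSpace ℝ (Fin d) → EuclideanSpace ℝ (Fin d)) : Prop where
  isOpen : IsOpen Ω
  boundary : HasPiecewiseSmoothBoundary Ω
  continuousOn : ContinuousOn F (closure Ω)
  contDiffOn : ContDiffOn ℝ 1 F Ω
  integrableOn : IntegrableOn (divergence F) Ω

/-- The difference between the two sides of the Gauss–Green formula for the field `χ F`. -/
noncomputable def gaussGreenDefect (Ω : Set (EuclideanSpace ℝ (Fin d)))
    (F : EuclideanSpace ℝ (Fin d) → EuclideanSpace ℝ (Fin d)) (χ : EuclideanSpace ℝ (Fin d) → ℝ) :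
    ℝ :=
  (∫ x in Ω, divergence (fun y => χ y • F y) x) -
    ∫ x in frontier Ω, inner ℝ (χ x • F x) (outwardUnitNormal Ω x) ∂μHE[d - 1]

namespace IsFluxField
variable {Ω : Set (EuclideanSpace ℝ (Fin d))}
  {F : EuclideanSpace ℝ (Fin d) → EuclideanSpace ℝ (Fin d)} {χ : EuclideanSpace ℝ (Fin d) → ℝ}

theorem differentiableAt (h : IsFluxField Ω F) {x : EuclideanSpace ℝ (Fin d)} (hx : x ∈ Ω) :
    DifferentiableAt ℝ F x :=
  (h.contDiffOn.contDiffAt (h.isOpen.mem_nhds hx)).differentiableAt one_ne_zero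

theorem aestronglyMeasurable_normal (h : IsFluxField Ω F) :
    AEStronglyMeasurable (outwardUnitNormal Ω) ((μHE[d - 1]).restrict (frontier Ω)) :=
  aestronglyMeasurable_outwardUnitNormal h.isOpen h.boundary.2

theorem continuousOn_smul (h : IsFluxField Ω F) (hχ : ContDiff ℝ 1 χ) :
    ContinuousOn (fun x => χ x • F x) (closure Ω) :=
  hχ.continuous.continuousOn.smul h.continuousOn

theorem integrableOn_fderiv_apply (h : IsFluxField Ω F) (hχ : ContDiff ℝ 1 χ)
    (hcs : HasCompactSupport χ) : IntegrableOn (fun x => fderiv ℝ χ x (F x)) Ω := by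
  have hc : ContinuousOn (fun x => fderiv ℝ χ x (F x)) (closure Ω) :=
    (hχ.continuous_fderiv one_ne_zero).continuousOn.clm_apply h.continuousOn
  have hK : IntegrableOn (fun x => fderiv ℝ χ x (F x)) (closure Ω ∩ tsupport χ) :=
    (hc.mono inter_subset_left).integrableOn_compact (hcs.isCompact.inter_left isClosed_closure)
  refine (hK.of_forall_sdiff_eq_zero isClosed_closure.measurableSet ?_).mono_set subset_closure
  rintro x ⟨hx, hx'⟩
  exact fderiv_apply_eq_zero_of_notMem_tsupport fun hs => hx' ⟨hx, hs⟩

theorem integrableOn_mul_divergence (h : IsFluxField Ω F) (hχ : Continuous χ)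
    (hcs : HasCompactSupport χ) : IntegrableOn (fun x => χ x * divergence F x) Ω := by
  obtain ⟨C, hC⟩ := hχ.bounded_above_of_compact_support hcs
  exact h.integrableOn.bdd_mul hχ.aestronglyMeasurable (Eventually.of_forall hC)

theorem divergence_smul_eq (h : IsFluxField Ω F) (hχ : ContDiff ℝ 1 χ)
    {x : EuclideanSpace ℝ (Fin d)} (hx : x ∈ Ω) : divergence (fun y => χ y • F y) x =
      χ x * divergence F x + fderiv ℝ χ x (F x) :=
  divergence_smul (hχ.differentiable one_ne_zero x) (h.differentiableAt hx)

theorem integrableOn_divergence_smul (h : IsFluxField Ω F) (hχ : ContDiff ℝ 1 χ)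
    (hcs : HasCompactSupport χ) : IntegrableOn (divergence fun x => χ x • F x) Ω := by
  refine ((h.integrableOn_mul_divergence hχ.continuous hcs).add
    (h.integrableOn_fderiv_apply hχ hcs)).congr ?_
  filter_upwards [ae_restrict_mem h.isOpen.measurableSet] with x hx
  exact (h.divergence_smul_eq hχ hx).symm

theorem integral_divergence_smul (h : IsFluxField Ω F) (hχ : ContDiff ℝ 1 χ)
    (hcs : HasCompactSupport χ) : ∫ x in Ω, divergence (fun y => χ y • F y) x =
      (∫ x in Ω, χ x * divergence F x) + ∫ x in Ω, fderiv ℝ χ x (F x) := by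
  rw [setIntegral_congr_fun h.isOpen.measurableSet fun x hx => h.divergence_smul_eq hχ hx]
  exact integral_add (h.integrableOn_mul_divergence hχ.continuous hcs)
    (h.integrableOn_fderiv_apply hχ hcs)

theorem measure_frontier_inter_lt_top (h : IsFluxField Ω F) {A : Set (EuclideanSpace ℝ (Fin d))}
    (hA : Bornology.IsBounded A) : μHE[d - 1] (frontier Ω ∩ A) < ⊤ := by
  obtain ⟨r, hr⟩ := hA.subset_closedBall 0
  exact (measure_mono (inter_subset_inter_right _ hr)).trans_lt (h.boundary.1 r)

/-- Fields that are continuous on the boundary and have bounded support are integrable there. -/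
theorem integrableOn_frontier_smul (h : IsFluxField Ω F) (hχ : Continuous χ)
    (hcs : HasCompactSupport χ) : IntegrableOn (fun x => χ x • F x) (frontier Ω) μHE[d - 1] := by
  have hc : ContinuousOn (fun x => χ x • F x) (frontier Ω ∩ tsupport χ) :=
    hχ.continuousOn.smul (h.continuousOn.mono (inter_subset_left.trans frontier_subset_closure))
  have hcpt : IsCompact (frontier Ω ∩ tsupport χ) := hcs.isCompact.inter_left isClosed_frontier
  obtain ⟨C, hC⟩ := hcpt.exists_bound_of_continuousOn hc
  have hfin : IsFiniteMeasure ((μHE[d - 1] : Measure (EuclideanSpace ℝ (Fin d))).restrict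
      (frontier Ω ∩ tsupport χ)) :=
    ⟨by
      rw [restrict_apply_univ]
      exact h.measure_frontier_inter_lt_top hcs.isCompact.isBounded⟩
  have hK : IntegrableOn (fun x => χ x • F x) (frontier Ω ∩ tsupport χ) μHE[d - 1] := by
    refine (integrable_const C).mono' (hc.aestronglyMeasurable hcpt.measurableSet) ?_
    filter_upwards [ae_restrict_mem hcpt.measurableSet] with x hx
    exact hC x hx
  refine hK.of_forall_sdiff_eq_zero isClosed_frontier.measurableSet ?_
  rintro x ⟨hx, hx'⟩
  rw [image_eq_zero_of_notMem_tsupport fun hs => hx' ⟨hx, hs⟩, zero_smul]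

theorem integrableOn_frontier_inner (h : IsFluxField Ω F) (hχ : Continuous χ)
    (hcs : HasCompactSupport χ) :
    IntegrableOn (fun x => inner ℝ (χ x • F x) (outwardUnitNormal Ω x)) (frontier Ω) μHE[d - 1] := by
  have h1 := h.integrableOn_frontier_smul hχ hcs
  refine h1.norm.mono (h1.aestronglyMeasurable.inner h.aestronglyMeasurable_normal)
    (Eventually.of_forall fun x => ?_)
  rw [norm_norm]
  exact (norm_inner_le_norm _ _).trans
    (mul_le_of_le_one_right (norm_nonneg _) (norm_outwardUnitNormal_le x))

theorem gaussGreenDefect_eq_zero_of_tsupport_subset (h : IsFluxField Ω F) (hχ : ContDiff ℝ 1 χ)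
    (hcs : HasCompactSupport χ) (hsub : tsupport χ ⊆ Ω) : gaussGreenDefect Ω F χ = 0 := by
  have hV : ContDiff ℝ 1 (fun x => χ x • F x) := by
    rw [contDiff_iff_contDiffAt]
    intro x
    by_cases hx : x ∈ tsupport χ
    · exact hχ.contDiffAt.smul (h.contDiffOn.contDiffAt (h.isOpen.mem_nhds (hsub hx)))
    · refine (contDiffAt_const (c := (0 : EuclideanSpace ℝ (Fin d)))).congr_of_eventuallyEq ?_
      filter_upwards [notMem_tsupport_iff_eventuallyEq.1 hx] with y hy
      simp [hy]
  have hsup : tsupport (fun x => χ x • F x) ⊆ tsupport χ := tsupport_smul_subset_left χ F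
  have h1 : ∫ x in Ω, divergence (fun y => χ y • F y) x = 0 := by
    rw [setIntegral_eq_integral_of_forall_compl_eq_zero, integral_divergence_eq_zero hV
      (hcs.smul_right)]
    exact fun x hx => divergence_eq_zero_of_notMem_tsupport fun hs => hx (hsub (hsup hs))
  rw [gaussGreenDefect, h1, zero_sub, neg_eq_zero]
  refine setIntegral_eq_zero_of_forall_eq_zero fun x hx => ?_
  have hx' : x ∉ tsupport χ := fun hs => (h.isOpen.frontier_eq ▸ hx).2 (hsub hs)
  rw [image_eq_zero_of_notMem_tsupport hx', zero_smul, inner_zero_left]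

theorem gaussGreenDefect_eq_zero_of_disjoint (hsub : tsupport χ ⊆ (closure Ω)ᶜ) :
    gaussGreenDefect Ω F χ = 0 := by
  have hsup : tsupport (fun x => χ x • F x) ⊆ tsupport χ := tsupport_smul_subset_left χ F
  have h1 : ∫ x in Ω, divergence (fun y => χ y • F y) x = 0 :=
    setIntegral_eq_zero_of_forall_eq_zero fun x hx =>
      divergence_eq_zero_of_notMem_tsupport fun hs => hsub (hsup hs) (subset_closure hx)
  rw [gaussGreenDefect, h1, zero_sub, neg_eq_zero]
  refine setIntegral_eq_zero_of_forall_eq_zero fun x hx => ?_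
  rw [image_eq_zero_of_notMem_tsupport fun hs => hsub hs (frontier_subset_closure hx), zero_smul,
    inner_zero_left]

/-- Away from the singular part of the boundary, the Gauss–Green formula holds up to an arbitrarily
small multiple of `∫_∂Ω ‖χ F‖`, for cutoffs with small support. -/
theorem exists_abs_gaussGreenDefect_le (h : IsFluxField Ω F) (hd : 0 < d)
    {x : EuclideanSpace ℝ (Fin d)} (hx : x ∉ singularBoundary Ω) {ε : ℝ} (hε : 0 < ε) :
    ∃ U, IsOpen U ∧ x ∈ U ∧ ∀ χ : EuclideanSpace ℝ (Fin d) → ℝ, ContDiff ℝ 1 χ →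
      HasCompactSupport χ → tsupport χ ⊆ U →
      |gaussGreenDefect Ω F χ| ≤ ε * ∫ x in frontier Ω, ‖χ x • F x‖ ∂μHE[d - 1] := by
  have hnonneg : ∀ χ : EuclideanSpace ℝ (Fin d) → ℝ,
      0 ≤ ε * ∫ x in frontier Ω, ‖χ x • F x‖ ∂μHE[d - 1] := fun χ =>
    mul_nonneg hε.le (integral_nonneg fun _ => norm_nonneg _)
  by_cases hxΩ : x ∈ Ω
  · refine ⟨Ω, h.isOpen, hxΩ, fun χ hχ hcs hsub => ?_⟩
    rw [h.gaussGreenDefect_eq_zero_of_tsupport_subset hχ hcs hsub, abs_zero]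
    exact hnonneg χ
  by_cases hxc : x ∈ closure Ω
  swap
  · refine ⟨(closure Ω)ᶜ, isClosed_closure.isOpen_compl, hxc, fun χ hχ hcs hsub => ?_⟩
    rw [gaussGreenDefect_eq_zero_of_disjoint hsub, abs_zero]
    exact hnonneg χ
  have hxf : x ∈ frontier Ω := h.isOpen.frontier_eq ▸ ⟨hxc, hxΩ⟩
  obtain ⟨ν, hν⟩ : ∃ ν, IsOutwardUnitNormal Ω x ν := by
    by_contra hc
    exact hx ⟨hxf, hc⟩
  -- `8 d + 1` is the constant of `IsConeSublevel.abs_integral_divergence_sub_le`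
  set δ : ℝ := min (ε / (8 * d + 1)) (1 / 2) with hδ
  have hδ0 : 0 < δ := lt_min (by positivity) (by norm_num)
  have hδε : (8 * d + 1) * δ ≤ ε := by
    calc _ ≤ (8 * d + 1) * (ε / (8 * d + 1)) := by
          gcongr
          exact min_le_left _ _
      _ = ε := by field_simp
  obtain ⟨η, ⟨⟨h₁, h₂⟩, h₃, h₄⟩, hη0⟩ : ∃ η : ℝ, (((1 + 4 * η) ^ (d - 1) < 1 + δ ∧
      1 - δ < (1 - 4 * η) ^ (d - 1)) ∧ η < 1 / 8 ∧ η < δ) ∧ 0 < η := by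
    have c₁ : ContinuousAt (fun η : ℝ => (1 + 4 * η) ^ (d - 1)) 0 := by fun_prop
    have c₂ : ContinuousAt (fun η : ℝ => (1 - 4 * η) ^ (d - 1)) 0 := by fun_prop
    have e₁ := c₁.eventually_lt (continuousAt_const (y := 1 + δ)) (by simpa using hδ0)
    have e₂ := (continuousAt_const (y := 1 - δ)).eventually_lt c₂ (by simpa using hδ0)
    have e₃ : ∀ᶠ η : ℝ in 𝓝 0, η < 1 / 8 ∧ η < δ :=
      (gt_mem_nhds (by norm_num)).and (gt_mem_nhds hδ0)
    exact ((((e₁.and e₂).and e₃).filter_mono nhdsWithin_le_nhds).and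
      (self_mem_nhdsWithin (s := Ioi 0))).exists
  obtain ⟨r, hr, ⟨g, hg⟩, hnear⟩ := hν.exists_isConeSublevel h.isOpen hη0
  refine ⟨Metric.ball x r, Metric.isOpen_ball, Metric.mem_ball_self hr, fun χ hχ hcs hsub => ?_⟩
  have hsup : tsupport (fun x => χ x • F x) ⊆ tsupport χ := tsupport_smul_subset_left χ F
  have key := hg.abs_integral_divergence_sub_le (V := fun x => χ x • F x) hν.norm_eq_one hd hη0.le h₃
    hδ0.le ((min_le_right _ _).trans_lt (by norm_num)) h₁.le h₂.le h.isOpen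
    (fun y hy => (hnear y hy).trans h₄.le) h.aestronglyMeasurable_normal
    (h.measure_frontier_inter_lt_top Metric.isBounded_ball) hcs.smul_right (hsup.trans hsub)
    (h.continuousOn_smul hχ) (hχ.contDiffOn.smul h.contDiffOn)
    (h.integrableOn_divergence_smul hχ hcs)
  have hzero : ∀ y ∈ frontier Ω \ (frontier Ω ∩ Metric.ball x r), χ y = 0 := fun y hy =>
    image_eq_zero_of_notMem_tsupport fun hs => hy.2 ⟨hy.1, hsub hs⟩
  rw [← setIntegral_eq_of_subset_of_forall_sdiff_eq_zero isClosed_frontier.measurableSet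
      inter_subset_left (fun y hy => by rw [hzero y hy, zero_smul, inner_zero_left]),
    ← setIntegral_eq_of_subset_of_forall_sdiff_eq_zero isClosed_frontier.measurableSet
      inter_subset_left (fun y hy => by rw [hzero y hy, zero_smul, norm_zero])] at key
  refine key.trans ?_
  gcongr

theorem gaussGreenDefect_sum (h : IsFluxField Ω F) {ι : Type*} (s : Finset ι)
    {f : ι → EuclideanSpace ℝ (Fin d) → ℝ} (hf : ∀ i ∈ s, ContDiff ℝ 1 (f i))
    (hcs : ∀ i ∈ s, HasCompactSupport (f i)) :
    gaussGreenDefect Ω F (fun x => ∑ i ∈ s, f i x) = ∑ i ∈ s, gaussGreenDefect Ω F (f i) := by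
  simp only [gaussGreenDefect, Finset.sum_sub_distrib]
  congr 1
  · rw [← integral_finsetSum _ fun i hi => h.integrableOn_divergence_smul (hf i hi) (hcs i hi)]
    refine setIntegral_congr_fun h.isOpen.measurableSet fun x hx => ?_
    have hsum : ContDiff ℝ 1 fun x => ∑ i ∈ s, f i x := ContDiff.sum hf
    simp only [h.divergence_smul_eq hsum hx]
    rw [fderiv_fun_sum fun i hi => (hf i hi).differentiable one_ne_zero x, Finset.sum_mul,
      _root_.sum_apply, ← Finset.sum_add_distrib]
    exact Finset.sum_congr rfl fun i hi => (h.divergence_smul_eq (hf i hi) hx).symm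
  · rw [← integral_finsetSum _ fun i hi => h.integrableOn_frontier_inner (hf i hi).continuous
      (hcs i hi)]
    simp only [Finset.sum_smul, sum_inner]

/-- The Gauss–Green formula for fields supported away from the singular part of the boundary. -/
theorem gaussGreenDefect_eq_zero_of_disjoint_singularBoundary (h : IsFluxField Ω F) (hd : 0 < d)
    (hχ : ContDiff ℝ 1 χ) (hcs : HasCompactSupport χ)
    (hdisj : Disjoint (tsupport χ) (singularBoundary Ω)) : gaussGreenDefect Ω F χ = 0 := by
  set I := ∫ x in frontier Ω, ‖χ x • F x‖ ∂μHE[d - 1] with hI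
  suffices hle : ∀ ε : ℝ, 0 < ε → |gaussGreenDefect Ω F χ| ≤ ε * I by
    have hlim : Tendsto (fun ε : ℝ => ε * I) (𝓝[>] 0) (𝓝 0) := by
      have hc : Continuous fun ε : ℝ => ε * I := by fun_prop
      simpa using hc.continuousAt.tendsto.mono_left (nhdsWithin_le_nhds (a := (0 : ℝ)))
    have h0 := ge_of_tendsto hlim (by
      filter_upwards [self_mem_nhdsWithin] with ε hε
      exact hle ε hε)
    exact abs_nonpos_iff.1 h0
  intro ε hε
  choose U hUo hxU hU using fun x : tsupport χ =>
    h.exists_abs_gaussGreenDefect_le hd (disjoint_left.1 hdisj x.2) hε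
  obtain ⟨f, hf⟩ := SmoothPartitionOfUnity.exists_isSubordinate
    (modelWithCornersSelf ℝ (EuclideanSpace ℝ (Fin d))) (isClosed_tsupport χ) U hUo
    (fun x hx => mem_iUnion.2 ⟨⟨x, hx⟩, hxU ⟨x, hx⟩⟩)
  have hfin := f.locallyFinite.finite_nonempty_inter_compact hcs.isCompact
  set s := hfin.toFinset with hs
  have hfs : ∀ i, ContDiff ℝ 1 (f i) := fun i =>
    ((f i).contMDiff.contDiff).of_le (by exact_mod_cast le_top)
  have hsum1 : ∀ x ∈ tsupport χ, ∑ i ∈ s, f i x = 1 := by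
    intro x hx
    rw [← f.sum_eq_one hx]
    refine (finsum_eq_sum_of_support_subset _ fun i hi => ?_).symm
    rw [hs, hfin.coe_toFinset]
    exact ⟨x, hi, hx⟩
  have hdec : (fun x => ∑ i ∈ s, f i x * χ x) = χ := by
    ext x
    rw [← Finset.sum_mul]
    by_cases hx : x ∈ tsupport χ
    · rw [hsum1 x hx, one_mul]
    · rw [image_eq_zero_of_notMem_tsupport hx, mul_zero]
  have hsm : ∀ i, ContDiff ℝ 1 fun x => f i x * χ x := fun i => (hfs i).mul hχ
  have hsc : ∀ i, HasCompactSupport fun x => f i x * χ x := fun i => hcs.mul_left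
  have hsub : ∀ i, tsupport (fun x => f i x * χ x) ⊆ U i := fun i =>
    (tsupport_mul_subset_left (f := f i) (g := χ)).trans (hf i)
  have hI' : ∑ i ∈ s, ∫ x in frontier Ω, ‖(f i x * χ x) • F x‖ ∂μHE[d - 1] = I := by
    rw [← integral_finsetSum _ fun i _ =>
      (h.integrableOn_frontier_smul (hsm i).continuous (hsc i)).norm]
    refine integral_congr_ae (Eventually.of_forall fun x => ?_)
    simp only [mul_smul, norm_smul (f _ x), Real.norm_of_nonneg (f.nonneg _ x), ← Finset.sum_mul]
    by_cases hx : x ∈ tsupport χ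
    · rw [hsum1 x hx, one_mul]
    · rw [image_eq_zero_of_notMem_tsupport hx, zero_smul, norm_zero, mul_zero]
  calc |gaussGreenDefect Ω F χ| = |∑ i ∈ s, gaussGreenDefect Ω F fun x => f i x * χ x| := by
        rw [← h.gaussGreenDefect_sum s (fun i _ => hsm i) (fun i _ => hsc i), hdec]
    _ ≤ ∑ i ∈ s, |gaussGreenDefect Ω F fun x => f i x * χ x| := Finset.abs_sum_le_sum_abs _ _
    _ ≤ ∑ i ∈ s, ε * ∫ x in frontier Ω, ‖(f i x * χ x) • F x‖ ∂μHE[d - 1] :=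
        Finset.sum_le_sum fun i _ => hU i _ (hsm i) (hsc i) (hsub i)
    _ = ε * I := by rw [← Finset.mul_sum, hI']
end IsFluxField
end

/-! ### Removal of the singular part of the boundary -/

/-- A compact set of surface area zero has finite covers by small balls of small total area. -/
theorem IsCompact.exists_finset_cover_balls {X : Type*} [Nonempty X] [MetricSpace X]
    [MeasurableSpace X] [BorelSpace X] {K : Set X} (hK : IsCompact K) {n : ℕ} (h0 : μHE[n] K = 0) {ε : ℝ}
    (hε : 0 < ε) : ∃ (s : Finset ℕ) (c : ℕ → X) (r : ℕ → ℝ),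
      (∀ i ∈ s, c i ∈ K ∧ 0 < r i ∧ r i ≤ ε) ∧ K ⊆ ⋃ i ∈ s, Metric.ball (c i) (r i) ∧
      ∑ i ∈ s, r i ^ n ≤ ε := by
  rcases K.eq_empty_or_nonempty with rfl | ⟨x₀, hx₀⟩
  · exact ⟨∅, fun _ => Classical.arbitrary X, fun _ => 1, by simp, by simp, by simpa using hε.le⟩
  have hH : μH[(n : ℝ)] K = 0 := by
    rw [euclideanHausdorffMeasure_def, Measure.smul_apply, ENNReal.smul_def, smul_eq_mul,
      mul_eq_zero] at h0
    exact h0.resolve_left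
      (by simpa using addHaarScalarFactor_volume_hausdorffMeasure_ne_zero n)
  rw [hausdorffMeasure_apply] at hH
  have h1 := (ENNReal.iSup_eq_zero.1 (ENNReal.iSup_eq_zero.1 hH (ENNReal.ofReal (ε / 2))))
    (by simpa using hε)
  obtain ⟨t, ht⟩ := iInf_lt_iff.1 (h1.trans_lt (show (0 : ENNReal) < ENNReal.ofReal (ε / 2) by
    simpa using hε))
  obtain ⟨htK, ht⟩ := iInf_lt_iff.1 ht
  obtain ⟨htd, ht⟩ := iInf_lt_iff.1 ht
  set D : ℕ → ℝ := fun i => (Metric.ediam (t i)).toReal with hD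
  have htop : ∀ i, Metric.ediam (t i) ≠ ⊤ := fun i => ((htd i).trans_lt ENNReal.ofReal_lt_top).ne
  have hDε : ∀ i, D i < ε := fun i => by
    have := ENNReal.toReal_mono ENNReal.ofReal_ne_top (htd i)
    rw [ENNReal.toReal_ofReal (by positivity)] at this
    have h2 : D i ≤ ε / 2 := this
    linarith
  -- the radius exceeds the diameter, which may be zero, by so little that the total area stays small
  have hr : ∀ i, ∃ r, (r ^ n < D i ^ n + ε / 2 / 2 / 2 ^ i ∧ r < ε) ∧ D i < r := fun i => by
    have c₁ : ContinuousAt (fun r : ℝ => r ^ n) (D i) := by fun_prop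
    have e₁ := c₁.eventually_lt (continuousAt_const (y := D i ^ n + ε / 2 / 2 / 2 ^ i))
      (by simp only [lt_add_iff_pos_right]; positivity)
    exact (((e₁.and (gt_mem_nhds (hDε i))).filter_mono nhdsWithin_le_nhds).and
      (self_mem_nhdsWithin (s := Ioi (D i)))).exists
  choose r hr using hr
  -- centres are chosen in `K`, which keeps the balls close to `K`
  have hc : ∀ i, ∃ c, (t i ∩ K).Nonempty → c ∈ t i ∩ K := fun i => by
    by_cases h : (t i ∩ K).Nonempty
    · exact ⟨h.choose, fun _ => h.choose_spec⟩
    · exact ⟨x₀, fun h' => absurd h' h⟩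
  choose c hc using hc
  obtain ⟨b', hb', hfin, hcov⟩ := hK.elim_finite_subcover_image
    (b := {i | (t i ∩ K).Nonempty}) (c := fun i => Metric.ball (c i) (r i))
    (fun i _ => Metric.isOpen_ball) (by
      intro x hx
      obtain ⟨i, hi⟩ := mem_iUnion.1 (htK hx)
      have hne : (t i ∩ K).Nonempty := ⟨x, hi, hx⟩
      refine mem_iUnion₂.2 ⟨i, hne, ?_⟩
      rw [Metric.mem_ball]
      refine lt_of_le_of_lt ?_ (hr i).2
      rw [dist_edist]
      exact ENNReal.toReal_mono (htop i) (Metric.edist_le_ediam_of_mem hi (hc i hne).1))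
  refine ⟨hfin.toFinset, c, r, fun i hi => ?_, by simpa using hcov, ?_⟩
  · have hne := hb' (hfin.mem_toFinset.1 hi)
    exact ⟨(hc i hne).2, ENNReal.toReal_nonneg.trans_lt (hr i).2, (hr i).1.2.le⟩
  · have hsum1 : ∑ i ∈ hfin.toFinset, D i ^ n ≤ ε / 2 := by
      rw [← ENNReal.ofReal_le_ofReal_iff (by positivity),
        ENNReal.ofReal_sum_of_nonneg fun i _ => pow_nonneg ENNReal.toReal_nonneg _]
      refine le_trans ?_ ht.le
      refine le_trans (Finset.sum_le_sum fun i hi => ?_) (ENNReal.sum_le_tsum hfin.toFinset)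
      have hne := (hb' (hfin.mem_toFinset.1 hi)).mono inter_subset_left
      rw [iSup_pos hne, ENNReal.ofReal_pow ENNReal.toReal_nonneg, ENNReal.ofReal_toReal (htop i),
        ENNReal.rpow_natCast]
    have hsum2 : ∑ i ∈ hfin.toFinset, ε / 2 / 2 / 2 ^ i ≤ ε / 2 := by
      have := (summable_geometric_two' (ε / 2)).sum_le_tsum hfin.toFinset
        (fun i _ => by positivity)
      rwa [tsum_geometric_two'] at this
    calc _ ≤ ∑ i ∈ hfin.toFinset, (D i ^ n + ε / 2 / 2 / 2 ^ i) :=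
          Finset.sum_le_sum fun i _ => (hr i).1.1.le
      _ ≤ ε := by
          rw [Finset.sum_add_distrib]
          linarith

section
variable {d : ℕ}

/-- Cutoffs that vanish on finitely many given balls, are one away from the doubled balls, and whose
gradient has an integral controlled by the total area of the balls. -/
theorem exists_cutoff_balls (hd : 0 < d) : ∃ C : ℝ, 0 ≤ C ∧ ∀ (s : Finset ℕ)
    (c : ℕ → EuclideanSpace ℝ (Fin d)) (r : ℕ → ℝ), (∀ i ∈ s, 0 < r i) →
    ∃ χ : EuclideanSpace ℝ (Fin d) → ℝ, ContDiff ℝ 1 χ ∧ (∀ x, 0 ≤ χ x ∧ χ x ≤ 1) ∧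
      (∀ i ∈ s, ∀ x ∈ Metric.ball (c i) (r i), χ x = 0) ∧
      (∀ x, (∀ i ∈ s, x ∉ Metric.ball (c i) (2 * r i)) → χ x = 1) ∧
      Integrable (fun x => ‖fderiv ℝ χ x‖) ∧ ∫ x, ‖fderiv ℝ χ x‖ ≤ C * ∑ i ∈ s, r i ^ (d - 1) := by
  let β : ContDiffBump (0 : EuclideanSpace ℝ (Fin d)) := ⟨1, 2, one_pos, one_lt_two⟩
  have hβ : ContDiff ℝ 1 β := β.contDiff
  have hβi : Integrable (fun x => ‖fderiv ℝ β x‖) :=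
    ((hβ.continuous_fderiv one_ne_zero).integrable_of_hasCompactSupport
      (β.hasCompactSupport.fderiv ℝ)).norm
  refine ⟨∫ x, ‖fderiv ℝ β x‖, integral_nonneg fun _ => norm_nonneg _, fun s c r hr => ?_⟩
  induction s using Finset.induction_on with
  | empty =>
    exact ⟨fun _ => 1, contDiff_const, fun _ => ⟨zero_le_one, le_rfl⟩, by simp, by simp, by simp,
      by simp⟩
  | insert i s his ih =>
    obtain ⟨χ, hχ, hχ01, hχ0, hχ1, hχi, hχb⟩ := ih fun j hj => hr j (Finset.mem_insert_of_mem hj)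
    have hri := hr i (Finset.mem_insert_self i s)
    set γ : EuclideanSpace ℝ (Fin d) → ℝ := fun x => β ((r i)⁻¹ • (x - c i)) with hγ
    have hγc : ContDiff ℝ 1 γ := hβ.comp (by fun_prop)
    have hγ01 : ∀ x, 0 ≤ γ x ∧ γ x ≤ 1 := fun x => ⟨β.nonneg, β.le_one⟩
    have hγd : ∀ x, fderiv ℝ γ x = (r i)⁻¹ • fderiv ℝ β ((r i)⁻¹ • (x - c i)) := fun x => by
      rw [hγ, fderiv_comp_sub (f := fun x => β ((r i)⁻¹ • x)), fderiv_comp_smul]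
    have hγn : ∀ x, ‖fderiv ℝ γ x‖ = (r i)⁻¹ * ‖fderiv ℝ β ((r i)⁻¹ • (x - c i))‖ := fun x => by
      rw [hγd, norm_smul, Real.norm_of_nonneg (by positivity)]
    have hγi : Integrable (fun x => ‖fderiv ℝ γ x‖) := by
      simp only [hγn]
      exact ((hβi.comp_smul (inv_ne_zero hri.ne')).comp_sub_right (c i)).const_mul _
    have hγb : ∫ x, ‖fderiv ℝ γ x‖ = (∫ x, ‖fderiv ℝ β x‖) * r i ^ (d - 1) := by
      simp only [hγn]
      rw [integral_const_mul, integral_sub_right_eq_self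
        (fun x => ‖fderiv ℝ β ((r i)⁻¹ • x)‖) (c i),
        Measure.integral_comp_inv_smul_of_nonneg _ (fun x => ‖fderiv ℝ β x‖) hri.le,
        finrank_euclideanSpace_fin, smul_eq_mul]
      obtain ⟨m, rfl⟩ : ∃ m, d = m + 1 := ⟨d - 1, by omega⟩
      rw [Nat.add_sub_cancel, pow_succ]
      field_simp
    have hdist : ∀ x, dist ((r i)⁻¹ • (x - c i)) 0 = (r i)⁻¹ * dist x (c i) := fun x => by
      rw [dist_zero_right, norm_smul, Real.norm_of_nonneg (by positivity), dist_eq_norm]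
    have hfd : ∀ x, ‖fderiv ℝ (fun y => χ y * (1 - γ y)) x‖ ≤
        ‖fderiv ℝ γ x‖ + ‖fderiv ℝ χ x‖ := fun x => by
      rw [fderiv_fun_mul (hχ.differentiable one_ne_zero x)
        ((hγc.differentiable one_ne_zero x).const_sub 1), fderiv_const_sub]
      refine (norm_add_le _ _).trans ?_
      rw [norm_smul, norm_smul, norm_neg, Real.norm_of_nonneg (hχ01 x).1,
        Real.norm_of_nonneg (by linarith [(hγ01 x).2])]
      exact add_le_add (mul_le_of_le_one_left (norm_nonneg _) (hχ01 x).2)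
        (mul_le_of_le_one_left (norm_nonneg _) (by linarith [(hγ01 x).1]))
    have hnew : ContDiff ℝ 1 (fun y => χ y * (1 - γ y)) := hχ.mul (contDiff_const.sub hγc)
    have hsumi : Integrable (fun x => ‖fderiv ℝ γ x‖ + ‖fderiv ℝ χ x‖) := hγi.add hχi
    have hnewi : Integrable (fun x => ‖fderiv ℝ (fun y => χ y * (1 - γ y)) x‖) :=
      hsumi.mono' (hnew.continuous_fderiv one_ne_zero).norm.aestronglyMeasurable
        (Eventually.of_forall fun x => by
          rw [norm_norm]
          exact hfd x)
    refine ⟨fun y => χ y * (1 - γ y), hnew, fun x => ?_, fun j hj x hx => ?_, fun x hx => ?_,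
      hnewi, ?_⟩
    · have h1 := hχ01 x
      have h2 := hγ01 x
      exact ⟨mul_nonneg h1.1 (by linarith), mul_le_one₀ h1.2 (by linarith) (by linarith)⟩
    · rcases Finset.mem_insert.1 hj with rfl | hj
      · have : γ x = 1 := by
          refine β.one_of_mem_closedBall ?_
          rw [Metric.mem_closedBall, hdist, inv_mul_le_iff₀ hri]
          simpa [β] using (Metric.mem_ball.1 hx).le
        simp [this]
      · simp [hχ0 j hj x hx]
    · have h1 := hχ1 x fun j hj => hx j (Finset.mem_insert_of_mem hj)
      have h2 : γ x = 0 := by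
        refine β.zero_of_le_dist ?_
        have h3 := hx i (Finset.mem_insert_self i s)
        rw [Metric.mem_ball, not_lt] at h3
        rw [hdist, le_inv_mul_iff₀ hri]
        simpa [β, mul_comm] using h3
      simp [h1, h2]
    · calc _ ≤ ∫ x, (‖fderiv ℝ γ x‖ + ‖fderiv ℝ χ x‖) := integral_mono hnewi hsumi hfd
        _ ≤ _ := by
          rw [integral_add hγi hχi, Finset.sum_insert his, mul_add, hγb]
          linarith

theorem tendsto_integral_mul_of_tendsto_one {α : Type*} {m : MeasurableSpace α} {μ : Measure α}
    {G : α → ℝ} (hG : Integrable G μ) {χ : ℕ → α → ℝ}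
    (hm : ∀ k, AEStronglyMeasurable (χ k) μ) (hχ : ∀ k x, 0 ≤ χ k x ∧ χ k x ≤ 1)
    (hlim : ∀ᵐ x ∂μ, Tendsto (fun k => χ k x) atTop (𝓝 1)) :
    Tendsto (fun k => ∫ x, χ k x * G x ∂μ) atTop (𝓝 (∫ x, G x ∂μ)) := by
  refine tendsto_integral_of_dominated_convergence (fun x => ‖G x‖)
    (fun k => (hm k).mul hG.aestronglyMeasurable) hG.norm (fun k => ?_) ?_
  · refine Eventually.of_forall fun x => ?_
    rw [norm_mul, Real.norm_of_nonneg (hχ k x).1]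
    exact mul_le_of_le_one_left (norm_nonneg _) (hχ k x).2
  · filter_upwards [hlim] with x hx
    simpa using hx.mul_const (G x)

/-- **Gauss–Green formula** for compactly supported multiples of `F`. The singular part of the
boundary is removed by cutoffs, whose gradients are negligible as the singular part has surface
area zero. -/
theorem IsFluxField.gaussGreenDefect_eq_zero {Ω : Set (EuclideanSpace ℝ (Fin d))}
    {F : EuclideanSpace ℝ (Fin d) → EuclideanSpace ℝ (Fin d)} {χ : EuclideanSpace ℝ (Fin d) → ℝ}
    (h : IsFluxField Ω F) (hd : 0 < d) (hχ : ContDiff ℝ 1 χ) (hcs : HasCompactSupport χ) :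
    gaussGreenDefect Ω F χ = 0 := by
  set K := singularBoundary Ω ∩ tsupport χ with hKdef
  have hK : IsCompact K := hcs.isCompact.inter_left (isClosed_singularBoundary h.isOpen)
  have hK0 : μHE[d - 1] K = 0 := measure_mono_null inter_subset_left h.boundary.2
  obtain ⟨C, hC0, hC⟩ := exists_cutoff_balls hd
  have hε : ∀ k : ℕ, (0 : ℝ) < 1 / (k + 1) := fun k => by positivity
  choose s c r hscr hcov hsum using fun k : ℕ => hK.exists_finset_cover_balls hK0 (hε k)
  choose χ' h1 h01 hz hone hint hbd using fun k => hC (s k) (c k) (r k) fun i hi =>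
    (hscr k i hi).2.1
  have hlim : ∀ x ∉ K, Tendsto (fun k => χ' k x) atTop (𝓝 1) := by
    intro x hx
    obtain ⟨ρ, hρ, hball⟩ := Metric.isOpen_iff.1 hK.isClosed.isOpen_compl x hx
    refine tendsto_const_nhds.congr' ?_
    filter_upwards [tendsto_one_div_add_atTop_nhds_zero_nat.eventually
      (gt_mem_nhds (half_pos hρ))] with k hk
    refine (hone k x fun i hi hxi => hball (a := c k i) ?_ (hscr k i hi).1).symm
    rw [Metric.mem_ball, dist_comm]
    have := Metric.mem_ball.1 hxi
    linarith [(hscr k i hi).2.2]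
  have hKΩ : ∀ x ∈ Ω, x ∉ K := fun x hx hxK => (h.isOpen.frontier_eq ▸ hxK.1.1).2 hx
  have hdefect : ∀ k, gaussGreenDefect Ω F (fun x => χ' k x * χ x) = 0 := fun k => by
    refine h.gaussGreenDefect_eq_zero_of_disjoint_singularBoundary hd ((h1 k).mul hχ) hcs.mul_left
      (disjoint_left.2 fun x hx hxs => ?_)
    have hxχ : x ∈ tsupport χ := tsupport_mul_subset_right (f := χ' k) (g := χ) hx
    obtain ⟨i, hi, hxi⟩ := mem_iUnion₂.1 (hcov k ⟨hxs, hxχ⟩)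
    refine notMem_tsupport_iff_eventuallyEq.2 ?_ hx
    filter_upwards [Metric.isOpen_ball.mem_nhds hxi] with y hy
    simp [hz k i hi y hy]
  have hsplit : ∀ k, (∫ x in Ω, χ' k x * (χ x * divergence F x)) +
      ((∫ x in Ω, χ' k x * fderiv ℝ χ x (F x)) + ∫ x in Ω, χ x * fderiv ℝ (χ' k) x (F x)) -
      ∫ x in frontier Ω, χ' k x * inner ℝ (χ x • F x) (outwardUnitNormal Ω x) ∂μHE[d - 1] = 0 := by
    intro k
    have hk := hdefect k
    rw [gaussGreenDefect, h.integral_divergence_smul ((h1 k).mul hχ) hcs.mul_left] at hk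
    have e1 : Integrable (fun x => χ' k x * fderiv ℝ χ x (F x)) (volume.restrict Ω) :=
      (h.integrableOn_fderiv_apply hχ hcs).bdd_mul (c := 1) (h1 k).continuous.aestronglyMeasurable
        (Eventually.of_forall fun x => by
          rw [Real.norm_of_nonneg (h01 k x).1]
          exact (h01 k x).2)
    have e2 : ∀ x, fderiv ℝ (fun y => χ' k y * χ y) x (F x) =
        χ' k x * fderiv ℝ χ x (F x) + χ x * fderiv ℝ (χ' k) x (F x) := fun x => by
      rw [fderiv_fun_mul ((h1 k).differentiable one_ne_zero x) (hχ.differentiable one_ne_zero x)]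
      simp
    have e3 : Integrable (fun x => χ x * fderiv ℝ (χ' k) x (F x)) (volume.restrict Ω) := by
      refine ((h.integrableOn_fderiv_apply ((h1 k).mul hχ) hcs.mul_left).sub e1).congr
        (Eventually.of_forall fun x => ?_)
      simp only [Pi.sub_apply, e2]
      ring
    simp only [e2] at hk
    rw [integral_add e1 e3] at hk
    simpa only [mul_assoc, mul_smul, real_inner_smul_left] using hk
  have hcm : ∀ (μ : Measure (EuclideanSpace ℝ (Fin d))) k, AEStronglyMeasurable (χ' k) μ :=
    fun μ k => (h1 k).continuous.aestronglyMeasurable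
  have L1 := tendsto_integral_mul_of_tendsto_one (h.integrableOn_mul_divergence hχ.continuous hcs)
    (hcm _) h01 ((ae_restrict_mem h.isOpen.measurableSet).mono fun x hx => hlim x (hKΩ x hx))
  have L2 := tendsto_integral_mul_of_tendsto_one (h.integrableOn_fderiv_apply hχ hcs)
    (hcm _) h01 ((ae_restrict_mem h.isOpen.measurableSet).mono fun x hx => hlim x (hKΩ x hx))
  have L3 := tendsto_integral_mul_of_tendsto_one (h.integrableOn_frontier_inner hχ.continuous hcs)
    (hcm _) h01 (by
      have : ∀ᵐ x ∂(μHE[d - 1] : Measure (EuclideanSpace ℝ (Fin d))).restrict (frontier Ω),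
          x ∉ K := ae_restrict_of_ae (measure_eq_zero_iff_ae_notMem.1 hK0)
      exact this.mono hlim)
  have L4 : Tendsto (fun k => ∫ x in Ω, χ x * fderiv ℝ (χ' k) x (F x)) atTop (𝓝 0) := by
    obtain ⟨B, hB⟩ := (hcs.isCompact.inter_left isClosed_closure).exists_bound_of_continuousOn
      ((h.continuousOn_smul hχ).mono inter_subset_left)
    set B' := max B 0 with hB'
    have hb : ∀ x ∈ Ω, ‖χ x • F x‖ ≤ B' := fun x hx => by
      by_cases hxs : x ∈ tsupport χ
      · exact (hB x ⟨subset_closure hx, hxs⟩).trans (le_max_left _ _)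
      · rw [image_eq_zero_of_notMem_tsupport hxs, zero_smul, norm_zero]
        exact le_max_right _ _
    have hle : ∀ k, ‖∫ x in Ω, χ x * fderiv ℝ (χ' k) x (F x)‖ ≤ B' * (C * (1 / (k + 1))) := fun k => by
      calc _ ≤ ∫ x in Ω, B' * ‖fderiv ℝ (χ' k) x‖ := by
            refine norm_integral_le_of_norm_le ((hint k).restrict.const_mul B') ?_
            filter_upwards [ae_restrict_mem h.isOpen.measurableSet] with x hx
            rw [← smul_eq_mul, ← map_smul]
            refine (ContinuousLinearMap.le_opNorm _ _).trans ?_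
            rw [mul_comm]
            gcongr
            exact hb x hx
        _ = B' * ∫ x in Ω, ‖fderiv ℝ (χ' k) x‖ := integral_const_mul _ _
        _ ≤ B' * ∫ x, ‖fderiv ℝ (χ' k) x‖ :=
            mul_le_mul_of_nonneg_left (setIntegral_le_integral (hint k)
              (Eventually.of_forall fun _ => norm_nonneg _)) (le_max_right _ _)
        _ ≤ _ := mul_le_mul_of_nonneg_left ((hbd k).trans
              (mul_le_mul_of_nonneg_left (hsum k) hC0)) (le_max_right _ _)
    refine squeeze_zero_norm hle ?_
    simpa using (tendsto_one_div_add_atTop_nhds_zero_nat.const_mul C).const_mul B'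
  have L := (L1.add (L2.add L4)).sub L3
  simp only [hsplit] at L
  have := tendsto_nhds_unique L tendsto_const_nhds
  rw [gaussGreenDefect, h.integral_divergence_smul hχ hcs]
  linarith
end

/-! ### Radial cutoffs and polar coordinates -/

/-- Integration in polar coordinates. -/
theorem integral_eq_integral_Ioi_toSphere {E : Type*} [NormedAddCommGroup E] [NormedSpace ℝ E]
    [MeasurableSpace E] [BorelSpace E] [FiniteDimensional ℝ E] [Nontrivial E] (μ : Measure E)
    [μ.IsAddHaarMeasure] {f : E → ℝ} (hf : Integrable f μ) :
    ∫ x, f x ∂μ = ∫ r in Ioi (0 : ℝ),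
      r ^ (finrank ℝ E - 1) * ∫ θ : Metric.sphere (0 : E) 1, f (r • (θ : E)) ∂μ.toSphere := by
  have hmp := μ.measurePreserving_homeomorphUnitSphereProd
  have hemb := (homeomorphUnitSphereProd E).measurableEmbedding
  have hsymm : ∀ x : ({0}ᶜ : Set E), (fun p : Metric.sphere (0 : E) 1 × Ioi (0 : ℝ) =>
      f (p.2.1 • p.1.1)) (homeomorphUnitSphereProd E x) = f x := fun x => by
    have := congrArg Subtype.val ((homeomorphUnitSphereProd E).symm_apply_apply x)
    rw [homeomorphUnitSphereProd_symm_apply_coe] at this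
    exact congrArg f this
  have hfi : Integrable (fun p : Metric.sphere (0 : E) 1 × Ioi (0 : ℝ) => f (p.2.1 • p.1.1))
      (μ.toSphere.prod (volumeIoiPow (finrank ℝ E - 1))) := by
    rw [← hmp.integrable_comp_emb hemb]
    refine (integrable_congr (Eventually.of_forall hsymm)).2 ?_
    exact (integrableOn_iff_comap_subtypeVal (measurableSet_singleton (0 : E)).compl).1
      hf.integrableOn
  calc ∫ x, f x ∂μ = ∫ x : ({0}ᶜ : Set E), f x ∂(μ.comap (↑)) := by
        rw [integral_subtype_comap (measurableSet_singleton _).compl f, restrict_compl_singleton]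
    _ = ∫ p : Metric.sphere (0 : E) 1 × Ioi (0 : ℝ), f (p.2.1 • p.1.1)
          ∂μ.toSphere.prod (volumeIoiPow (finrank ℝ E - 1)) := by
        rw [← hmp.integral_comp hemb]
        exact (integral_congr_ae (Eventually.of_forall hsymm)).symm
    _ = ∫ r : Ioi (0 : ℝ), (∫ θ : Metric.sphere (0 : E) 1, f (r.1 • (θ : E)) ∂μ.toSphere)
          ∂volumeIoiPow (finrank ℝ E - 1) := integral_prod_symm _ hfi
    _ = _ := by
        simp only [volumeIoiPow, ENNReal.ofReal]
        rw [integral_withDensity_eq_integral_smul (by fun_prop)]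
        rw [integral_subtype_comap measurableSet_Ioi fun r : ℝ => (r ^ (finrank ℝ E - 1)).toNNReal •
          ∫ θ : Metric.sphere (0 : E) 1, f (r • (θ : E)) ∂μ.toSphere]
        refine setIntegral_congr_fun measurableSet_Ioi fun r hr => ?_
        rw [NNReal.smul_def, Real.coe_toNNReal _ (pow_nonneg (le_of_lt hr) _), smul_eq_mul]

/-- The profile of a smooth radial cutoff: it is one for `r ^ 2 ≤ R` and zero for
`R + 1 ≤ r ^ 2`. -/
noncomputable def radialProfile (R r : ℝ) : ℝ := Real.smoothTransition (R + 1 - r ^ 2)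

/-- The negative of the derivative of `radialProfile`. -/
noncomputable def radialWeight (R r : ℝ) : ℝ := 2 * r * deriv Real.smoothTransition (R + 1 - r ^ 2)

theorem hasDerivAt_radialProfile (R r : ℝ) :
    HasDerivAt (radialProfile R) (-radialWeight R r) r := by
  have h1 : HasDerivAt Real.smoothTransition (deriv Real.smoothTransition (R + 1 - r ^ 2))
      (R + 1 - r ^ 2) :=
    ((Real.smoothTransition.contDiff (n := 1)).differentiable one_ne_zero _).hasDerivAt
  have h2 : HasDerivAt (fun r : ℝ => R + 1 - r ^ 2) (-(2 * r)) r := by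
    simpa using (hasDerivAt_pow 2 r).const_sub (R + 1)
  refine (h1.comp r h2).congr_deriv ?_
  rw [radialWeight]
  ring

theorem continuous_radialWeight (R : ℝ) : Continuous (radialWeight R) := by
  have h1 : Continuous (deriv Real.smoothTransition) :=
    (Real.smoothTransition.contDiff (n := 1)).continuous_deriv le_rfl
  unfold radialWeight
  fun_prop

theorem radialWeight_nonneg {R r : ℝ} (hr : 0 ≤ r) : 0 ≤ radialWeight R r :=
  mul_nonneg (by positivity) (Real.smoothTransition.monotone.deriv_nonneg)

theorem radialWeight_eq_zero_of_lt {R r : ℝ} (hr : r ^ 2 < R) : radialWeight R r = 0 := by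
  have : Real.smoothTransition =ᶠ[𝓝 (R + 1 - r ^ 2)] fun _ => 1 := by
    filter_upwards [lt_mem_nhds (show 1 < R + 1 - r ^ 2 by linarith)] with t ht
    exact Real.smoothTransition.one_of_one_le ht.le
  rw [radialWeight, this.deriv_eq, deriv_const, mul_zero]

theorem radialWeight_eq_zero_of_gt {R r : ℝ} (hr : R + 1 < r ^ 2) : radialWeight R r = 0 := by
  have : Real.smoothTransition =ᶠ[𝓝 (R + 1 - r ^ 2)] fun _ => 0 := by
    filter_upwards [gt_mem_nhds (show R + 1 - r ^ 2 < 0 by linarith)] with t ht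
    exact Real.smoothTransition.zero_of_nonpos ht.le
  rw [radialWeight, this.deriv_eq, deriv_const, mul_zero]

theorem integrable_radialWeight (R : ℝ) : Integrable (radialWeight R) := by
  refine (continuous_radialWeight R).integrable_of_hasCompactSupport
    (HasCompactSupport.intro (isCompact_Icc (a := -√(R + 1)) (b := √(R + 1))) fun r hr => ?_)
  refine radialWeight_eq_zero_of_gt (lt_of_not_ge fun hle => hr ?_)
  exact abs_le.1 (Real.abs_le_sqrt hle)

theorem integral_Ioi_radialWeight (R a : ℝ) :
    ∫ r in Ioi a, radialWeight R r = radialProfile R a := by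
  have hlim : Tendsto (radialProfile R) atTop (𝓝 0) := by
    refine tendsto_const_nhds.congr' ?_
    filter_upwards [(tendsto_pow_atTop two_ne_zero).eventually (eventually_ge_atTop (R + 1))]
      with r hr
    exact (Real.smoothTransition.zero_of_nonpos (by linarith)).symm
  have := integral_Ioi_of_hasDerivAt_of_tendsto' (a := a)
    (fun r _ => hasDerivAt_radialProfile R r) (integrable_radialWeight R).neg.integrableOn hlim
  simp only [integral_neg] at this
  linarith

/-- Averages against the radial weights converge to zero along with the averaged function. -/
theorem tendsto_integral_radialWeight_mul {f : ℝ → ℝ} (hf : Tendsto f atTop (𝓝 0)) :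
    Tendsto (fun k : ℕ => ∫ r in Ioi (0 : ℝ), radialWeight k r * f r) atTop (𝓝 0) := by
  rw [Metric.tendsto_atTop]
  intro ε hε
  obtain ⟨r₀, hr₀⟩ := eventually_atTop.1 (Metric.tendsto_nhds.1 hf (ε / 2) (by positivity))
  obtain ⟨N, hN⟩ := exists_nat_gt (r₀ ^ 2)
  refine ⟨N, fun k hk => ?_⟩
  rw [dist_zero_right]
  refine lt_of_le_of_lt ?_ (half_lt_self hε)
  have hkN : (N : ℝ) ≤ k := by exact_mod_cast hk
  calc _ ≤ ∫ r in Ioi (0 : ℝ), radialWeight k r * (ε / 2) := by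
        refine norm_integral_le_of_norm_le
          ((integrable_radialWeight k).integrableOn.mul_const _) ?_
        filter_upwards [ae_restrict_mem measurableSet_Ioi] with r hr
        have hr0 : (0 : ℝ) ≤ r := le_of_lt hr
        rw [norm_mul, Real.norm_of_nonneg (radialWeight_nonneg hr0)]
        rcases lt_or_ge (r ^ 2) k with hlt | hge
        · rw [radialWeight_eq_zero_of_lt hlt, zero_mul, zero_mul]
        · refine mul_le_mul_of_nonneg_left ?_ (radialWeight_nonneg hr0)
          have hr1 : r₀ ≤ r := by
            by_contra hc
            have : r ^ 2 < r₀ ^ 2 := by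
              rw [not_le] at hc
              gcongr
            linarith
          have := hr₀ r hr1
          rw [dist_zero_right] at this
          exact this.le
    _ = ε / 2 * radialProfile k 0 := by
        rw [integral_mul_const, integral_Ioi_radialWeight, mul_comm]
    _ ≤ ε / 2 := mul_le_of_le_one_right (by positivity) (Real.smoothTransition.le_one _)

section
variable {d : ℕ}

/-- The smooth cutoff with profile `radialProfile R`. -/
noncomputable def radialCutoff (d : ℕ) (R : ℝ) (x : EuclideanSpace ℝ (Fin d)) : ℝ :=
  radialProfile R ‖x‖

theorem contDiff_radialCutoff (R : ℝ) : ContDiff ℝ 1 (radialCutoff d R) :=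
  (Real.smoothTransition.contDiff (n := 1)).comp
    (contDiff_const.sub (contDiff_id.norm_sq ℝ))

theorem radialCutoff_nonneg_le_one (R : ℝ) (x : EuclideanSpace ℝ (Fin d)) :
    0 ≤ radialCutoff d R x ∧ radialCutoff d R x ≤ 1 :=
  ⟨Real.smoothTransition.nonneg _, Real.smoothTransition.le_one _⟩

theorem radialCutoff_eq_one {R : ℝ} {x : EuclideanSpace ℝ (Fin d)} (hx : ‖x‖ ^ 2 ≤ R) :
    radialCutoff d R x = 1 := Real.smoothTransition.one_of_one_le (by linarith)

theorem hasCompactSupport_radialCutoff (R : ℝ) : HasCompactSupport (radialCutoff d R) := by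
  refine HasCompactSupport.intro (isCompact_closedBall 0 √(R + 1)) fun x hx => ?_
  rw [mem_closedBall_zero_iff, not_le] at hx
  refine Real.smoothTransition.zero_of_nonpos ?_
  have := (Real.sqrt_lt' ((Real.sqrt_nonneg _).trans_lt hx)).1 hx
  linarith

theorem tendsto_radialCutoff (x : EuclideanSpace ℝ (Fin d)) :
    Tendsto (fun k : ℕ => radialCutoff d k x) atTop (𝓝 1) := by
  refine tendsto_const_nhds.congr' ?_
  filter_upwards [tendsto_natCast_atTop_atTop.eventually (eventually_ge_atTop (‖x‖ ^ 2))] with k hk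
  exact (radialCutoff_eq_one hk).symm

theorem fderiv_radialCutoff_smul (R : ℝ) {r : ℝ} {θ : EuclideanSpace ℝ (Fin d)} (hr : 0 ≤ r)
    (hθ : ‖θ‖ = 1) (v : EuclideanSpace ℝ (Fin d)) :
    fderiv ℝ (radialCutoff d R) (r • θ) v = -radialWeight R r * inner ℝ v θ := by
  have h1 : HasFDerivAt (fun x : EuclideanSpace ℝ (Fin d) => R + 1 - ‖x‖ ^ 2)
      (-(2 • innerSL ℝ (r • θ))) (r • θ) :=
    (hasStrictFDerivAt_norm_sq (r • θ)).hasFDerivAt.const_sub (R + 1)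
  have h2 : HasDerivAt Real.smoothTransition (deriv Real.smoothTransition (R + 1 - ‖r • θ‖ ^ 2))
      (R + 1 - ‖r • θ‖ ^ 2) :=
    ((Real.smoothTransition.contDiff (n := 1)).differentiable one_ne_zero _).hasDerivAt
  have h3 := (h2.comp_hasFDerivAt (r • θ) h1).fderiv
  have h4 : ‖r • θ‖ = r := by rw [norm_smul, hθ, mul_one, Real.norm_of_nonneg hr]
  rw [show radialCutoff d R = Real.smoothTransition ∘ fun x => R + 1 - ‖x‖ ^ 2 from rfl, h3, h4,
    radialWeight]
  simp [real_inner_comm]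
  ring

namespace IsFluxField
variable {Ω : Set (EuclideanSpace ℝ (Fin d))}
  {F : EuclideanSpace ℝ (Fin d) → EuclideanSpace ℝ (Fin d)}

theorem integral_fderiv_radialCutoff (h : IsFluxField Ω F) (hd : 0 < d) (R : ℝ) :
    ∫ x in Ω, fderiv ℝ (radialCutoff d R) x (F x) =
      -∫ r in Ioi (0 : ℝ), radialWeight R r * sphereFlux Ω F r := by
  have : Nonempty (Fin d) := ⟨⟨0, hd⟩⟩
  have hi := (integrable_indicator_iff h.isOpen.measurableSet).2
    (h.integrableOn_fderiv_apply (contDiff_radialCutoff R) (hasCompactSupport_radialCutoff R))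
  rw [← integral_indicator h.isOpen.measurableSet, integral_eq_integral_Ioi_toSphere _ hi,
    ← integral_neg]
  refine setIntegral_congr_fun measurableSet_Ioi fun r hr => ?_
  simp only [sphereFlux, finrank_euclideanSpace_fin]
  rw [← mul_assoc, mul_comm (radialWeight R r), mul_assoc, ← mul_neg, ← neg_mul]
  congr 1
  rw [← integral_const_mul]
  congr 1
  ext θ
  have hθ : ‖(θ : EuclideanSpace ℝ (Fin d))‖ = 1 := by simp
  by_cases hm : r • (θ : EuclideanSpace ℝ (Fin d)) ∈ Ω
  · rw [indicator_of_mem hm, if_pos hm, fderiv_radialCutoff_smul R (le_of_lt hr) hθ]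
  · rw [indicator_of_notMem hm, if_neg hm, mul_zero]

theorem integrableOn_frontier_inter (h : IsFluxField Ω F) {A : Set (EuclideanSpace ℝ (Fin d))}
    (hA : Bornology.IsBounded A) (hAm : MeasurableSet A) :
    IntegrableOn (fun x => inner ℝ (F x) (outwardUnitNormal Ω x)) (frontier Ω ∩ A) μHE[d - 1] := by
  obtain ⟨ρ, hρ⟩ := hA.subset_closedBall 0
  have h1 := (h.integrableOn_frontier_inner (contDiff_radialCutoff (ρ ^ 2)).continuous
    (hasCompactSupport_radialCutoff (ρ ^ 2))).mono_set (inter_subset_left (t := A))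
  refine h1.congr_fun (fun x hx => ?_) (isClosed_frontier.measurableSet.inter hAm)
  have hxρ := mem_closedBall_zero_iff.1 (hρ hx.2)
  simp only
  rw [radialCutoff_eq_one (by gcongr), one_smul]

theorem integral_frontier_radialCutoff (h : IsFluxField Ω F) {R : ℝ} (hR : 0 ≤ R) :
    ∫ x in frontier Ω, inner ℝ (radialCutoff d R x • F x) (outwardUnitNormal Ω x) ∂μHE[d - 1] =
      ∫ r in Ioi (0 : ℝ), radialWeight R r * boundaryFlux Ω F (Metric.ball 0 r) := by
  set B : Set (EuclideanSpace ℝ (Fin d)) := Metric.ball 0 (R + 2) with hB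
  have hBm : MeasurableSet (frontier Ω ∩ B) :=
    isClosed_frontier.measurableSet.inter Metric.isOpen_ball.measurableSet
  set G : EuclideanSpace ℝ (Fin d) → ℝ := fun x => inner ℝ (F x) (outwardUnitNormal Ω x) with hG
  have hGi : Integrable G ((μHE[d - 1]).restrict (frontier Ω ∩ B)) :=
    h.integrableOn_frontier_inter Metric.isBounded_ball Metric.isOpen_ball.measurableSet
  have hfin : IsFiniteMeasure ((μHE[d - 1] : Measure (EuclideanSpace ℝ (Fin d))).restrict
      (frontier Ω ∩ B)) :=
    ⟨by
      rw [restrict_apply_univ]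
      exact h.measure_frontier_inter_lt_top Metric.isBounded_ball⟩
  have hsq : ∀ t : ℝ, t ^ 2 ≤ R + 1 → t < R + 2 := fun t ht => by nlinarith
  have hprod : Integrable (fun p : EuclideanSpace ℝ (Fin d) × ℝ =>
      {p : EuclideanSpace ℝ (Fin d) × ℝ | ‖p.1‖ < p.2}.indicator
        (fun p => G p.1 * radialWeight R p.2) p)
      (((μHE[d - 1]).restrict (frontier Ω ∩ B)).prod (volume.restrict (Ioi 0))) :=
    (hGi.mul_prod (integrable_radialWeight R).restrict).indicator
      (measurableSet_lt (by fun_prop) (by fun_prop))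
  have hinner : ∀ x, ∫ r in Ioi (0 : ℝ), {p : EuclideanSpace ℝ (Fin d) × ℝ | ‖p.1‖ < p.2}.indicator
      (fun p => G p.1 * radialWeight R p.2) (x, r) = radialCutoff d R x * G x := fun x => by
    have e1 : ∀ r, {p : EuclideanSpace ℝ (Fin d) × ℝ | ‖p.1‖ < p.2}.indicator
        (fun p => G p.1 * radialWeight R p.2) (x, r) =
        (Ioi ‖x‖).indicator (fun r => G x * radialWeight R r) r := fun r => by
      simp [indicator]
    simp only [e1]
    rw [setIntegral_indicator measurableSet_Ioi, Ioi_inter_Ioi, max_eq_right (norm_nonneg x),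
      integral_const_mul, integral_Ioi_radialWeight, mul_comm]
    rfl
  calc _ = ∫ x in frontier Ω ∩ B, radialCutoff d R x * G x ∂μHE[d - 1] := by
        simp only [real_inner_smul_left]
        refine setIntegral_eq_of_subset_of_forall_sdiff_eq_zero isClosed_frontier.measurableSet
          inter_subset_left fun x hx => ?_
        have h2 : R + 2 ≤ ‖x‖ := by
          by_contra hc
          exact hx.2 ⟨hx.1, mem_ball_zero_iff.2 (not_le.1 hc)⟩
        have h3 : radialCutoff d R x = 0 :=
          Real.smoothTransition.zero_of_nonpos (by nlinarith)
        rw [h3, zero_mul]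
    _ = ∫ x in frontier Ω ∩ B, (∫ r in Ioi (0 : ℝ),
          {p : EuclideanSpace ℝ (Fin d) × ℝ | ‖p.1‖ < p.2}.indicator
            (fun p => G p.1 * radialWeight R p.2) (x, r)) ∂μHE[d - 1] := by
        simp only [hinner]
    _ = ∫ r in Ioi (0 : ℝ), ∫ x in frontier Ω ∩ B,
          {p : EuclideanSpace ℝ (Fin d) × ℝ | ‖p.1‖ < p.2}.indicator
            (fun p => G p.1 * radialWeight R p.2) (x, r) ∂μHE[d - 1] :=
        integral_integral_swap hprod
    _ = _ := by
        refine setIntegral_congr_fun measurableSet_Ioi fun r hr => ?_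
        simp only
        rcases lt_or_ge (R + 1) (r ^ 2) with hlt | hge
        · simp [indicator, radialWeight_eq_zero_of_gt hlt]
        have e1 : ∀ x, {p : EuclideanSpace ℝ (Fin d) × ℝ | ‖p.1‖ < p.2}.indicator
            (fun p => G p.1 * radialWeight R p.2) (x, r) =
            (Metric.ball 0 r).indicator (fun x => G x * radialWeight R r) x := fun x => by
          simp [indicator]
        simp only [e1]
        rw [setIntegral_indicator Metric.isOpen_ball.measurableSet, integral_mul_const, mul_comm,
          inter_assoc, inter_eq_right.2 (Metric.ball_subset_ball (hsq r hge).le)]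
        rfl

/-- The Gauss–Green formula for the radial cutoffs, with both boundary terms as radial averages. -/
theorem integral_radialCutoff_mul_divergence (h : IsFluxField Ω F) (hd : 0 < d) {R : ℝ}
    (hR : 0 ≤ R) : ∫ x in Ω, radialCutoff d R x * divergence F x =
      (∫ r in Ioi (0 : ℝ), radialWeight R r * sphereFlux Ω F r) +
        ∫ r in Ioi (0 : ℝ), radialWeight R r * boundaryFlux Ω F (Metric.ball 0 r) := by
  have h1 := h.gaussGreenDefect_eq_zero hd (contDiff_radialCutoff R)
    (hasCompactSupport_radialCutoff R)
  rw [gaussGreenDefect, h.integral_divergence_smul (contDiff_radialCutoff R)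
    (hasCompactSupport_radialCutoff R), h.integral_fderiv_radialCutoff hd,
    h.integral_frontier_radialCutoff hR] at h1
  linarith

theorem integral_divergence_eq_zero_of_tendsto (h : IsFluxField Ω F) (hd : 0 < d)
    (hs : Tendsto (fun r : ℝ => sphereFlux Ω F r) atTop (𝓝 0))
    (hb : Tendsto (fun r : ℝ => boundaryFlux Ω F (Metric.ball 0 r)) atTop (𝓝 0)) :
    ∫ x in Ω, divergence F x = 0 := by
  have h1 := tendsto_integral_mul_of_tendsto_one h.integrableOn
    (χ := fun k : ℕ => radialCutoff d k)
    (fun k => (contDiff_radialCutoff (k : ℝ)).continuous.aestronglyMeasurable)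
    (fun k => radialCutoff_nonneg_le_one k) (Eventually.of_forall tendsto_radialCutoff)
  simp only [h.integral_radialCutoff_mul_divergence hd (Nat.cast_nonneg _)] at h1
  have h2 := (tendsto_integral_radialWeight_mul hs).add (tendsto_integral_radialWeight_mul hb)
  rw [add_zero] at h2
  exact tendsto_nhds_unique h1 h2

/-- The **divergence theorem** on bounded domains. -/
theorem integral_divergence_eq_boundaryFlux (h : IsFluxField Ω F) (hd : 0 < d)
    (hΩ : Bornology.IsBounded Ω) : ∫ x in Ω, divergence F x = boundaryFlux Ω F univ := by
  obtain ⟨ρ, hρ⟩ := hΩ.subset_closedBall 0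
  have hcl : closure Ω ⊆ Metric.closedBall 0 ρ := closure_minimal hρ Metric.isClosed_closedBall
  have hone : ∀ x ∈ closure Ω, ∀ᶠ y in 𝓝 x, radialCutoff d (ρ ^ 2 + 1) y = 1 := fun x hx => by
    have hx' : ‖x‖ ^ 2 ≤ ρ ^ 2 := by
      have := mem_closedBall_zero_iff.1 (hcl hx)
      gcongr
    have hc : ContinuousAt (fun y : EuclideanSpace ℝ (Fin d) => ‖y‖ ^ 2) x := by fun_prop
    filter_upwards [hc.eventually (gt_mem_nhds (show ‖x‖ ^ 2 < ρ ^ 2 + 1 by linarith))] with y hy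
    exact radialCutoff_eq_one hy.le
  have h1 := h.gaussGreenDefect_eq_zero hd (contDiff_radialCutoff (ρ ^ 2 + 1))
    (hasCompactSupport_radialCutoff (ρ ^ 2 + 1))
  rw [gaussGreenDefect, sub_eq_zero] at h1
  rw [boundaryFlux, inter_univ]
  convert! h1 using 1
  · refine setIntegral_congr_fun h.isOpen.measurableSet fun x hx => ?_
    have hx' := hone x (subset_closure hx)
    rw [h.divergence_smul_eq (contDiff_radialCutoff _) hx, hx'.self_of_nhds,
      Filter.EventuallyEq.fderiv_eq (f := fun _ => (1 : ℝ)) hx']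
    simp
  · refine setIntegral_congr_fun isClosed_frontier.measurableSet fun x hx => ?_
    rw [(hone x (frontier_subset_closure hx)).self_of_nhds, one_smul]

theorem integral_divergence_eq_zero (h : IsFluxField Ω F) (hd : 0 < d)
    (hbc : SteinBoundaryCondition Ω F) : ∫ x in Ω, divergence F x = 0 := by
  by_cases hΩ : Bornology.IsBounded Ω
  · rw [h.integral_divergence_eq_boundaryFlux hd hΩ, hbc.1 hΩ]
  · exact h.integral_divergence_eq_zero_of_tendsto hd (hbc.2 hΩ).1 (hbc.2 hΩ).2
end IsFluxField

/-! ### The Stein control variate -/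

/-- The product of the Stein control variate with the density is a divergence. -/
theorem steinControl_mul_eq_divergence {π : EuclideanSpace ℝ (Fin d) → ℝ}
    {φ : EuclideanSpace ℝ (Fin d) → EuclideanSpace ℝ (Fin d)} {x : EuclideanSpace ℝ (Fin d)}
    (hx : 0 < π x) (hπ : DifferentiableAt ℝ π x) (hφ : DifferentiableAt ℝ φ x) :
    steinControl π φ x * π x = divergence (fun y => π y • φ y) x := by
  have h1 : inner ℝ (φ x) (gradient (fun y => Real.log (π y)) x) =
      (π x)⁻¹ * fderiv ℝ π x (φ x) := by
    rw [real_inner_comm, gradient, InnerProductSpace.toDual_symm_apply,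
      (hπ.hasFDerivAt.log hx.ne').fderiv]
    simp
  rw [steinControl, h1, divergence_smul hπ hφ]
  field_simp
end

theorem proposition2 (d : ℕ) (hd : 0 < d)
    -- the state space
    (Ω : Set (EuclideanSpace ℝ (Fin d))) (hΩ : IsOpen Ω) (hbdry : HasPiecewiseSmoothBoundary Ω)
    -- the probability density, positive and continuously differentiable on the state space
    (π : EuclideanSpace ℝ (Fin d) → ℝ) (hπ_pos : ∀ x ∈ Ω, 0 < π x) (hπ_one : ∫ x in Ω, π x = 1)
    (hπ : ContDiffOn ℝ 1 π Ω)
    -- the vector field, and the integrability without which the expectation has no meaning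
    (φ : EuclideanSpace ℝ (Fin d) → EuclideanSpace ℝ (Fin d)) (hφ : ContDiffOn ℝ 1 φ Ω)
    (hψ : MeasureTheory.IntegrableOn (fun x => steinControl π φ x * π x) Ω)
    -- `F` is `π φ` with its boundary values
    (F : EuclideanSpace ℝ (Fin d) → EuclideanSpace ℝ (Fin d)) (hF : ContinuousOn F (closure Ω))
    (hFΩ : ∀ x ∈ Ω, F x = π x • φ x)
    -- the boundary condition
    (hbc : SteinBoundaryCondition Ω F)
    (c : ℝ) :
    expectation Ω π (steinControl π φ) = 0 ∧
    expectation Ω π (fun x => c + steinControl π φ x) = c := by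
  have hdiv : ∀ x ∈ Ω, steinControl π φ x * π x = divergence F x := fun x hx => by
    have hnhds := hΩ.mem_nhds hx
    have hev : F =ᶠ[𝓝 x] fun y => π y • φ y := by
      filter_upwards [hnhds] with y hy
      exact hFΩ y hy
    rw [steinControl_mul_eq_divergence (hπ_pos x hx)
      ((hπ.contDiffAt hnhds).differentiableAt one_ne_zero)
      ((hφ.contDiffAt hnhds).differentiableAt one_ne_zero)]
    simp only [divergence, hev.fderiv_eq]
  have hflux : IsFluxField Ω F :=
    { isOpen := hΩ
      boundary := hbdry
      continuousOn := hF
      contDiffOn := (hπ.smul hφ).congr hFΩ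
      integrableOn := hψ.congr_fun hdiv hΩ.measurableSet }
  have h0 : expectation Ω π (steinControl π φ) = 0 := by
    rw [expectation, setIntegral_congr_fun hΩ.measurableSet hdiv]
    exact hflux.integral_divergence_eq_zero hd hbc
  refine ⟨h0, ?_⟩
  -- a function that is not integrable has integral zero
  have hπi : IntegrableOn π Ω := by
    by_contra hc
    rw [integral_undef hc] at hπ_one
    exact zero_ne_one hπ_one
  rw [expectation] at h0 ⊢
  simp only [add_mul]
  rw [integral_add (hπi.const_mul c) hψ, integral_const_mul, hπ_one, h0, mul_one, add_zero]
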